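/- For $\gamma,\delta\in\mathbb C$ with $\gamma\neq 0$ let $F_{\gamma,\delta}(z)=\dfrac{\gamma z}{z^2+\delta z+1}$, a quadratic rational map of the Riemann sphere $\widehat{\mathbb C}=\mathbb C\cup\{\infty\}$; it has a fixed point at $0$ with eigenvalue (derivative) $\gamma$. Let $F_k=F_{\gamma_k,\delta_k}$ $(k\in\mathbb N)$ with $\gamma_k\neq 0$ and $\gamma_k\to\infty$. Let $a_k,b_k\in\mathbb C$ be such that $[a_k,b_k,0]$ is the unordered triple of fixed points of $F_k$ listed with multiplicity, and let $\alpha_k=F_k'(a_k)$ and $\beta_k=F_k'(b_k)$. Assume that $\alpha_k\to\omega$, where $\omega\neq 1$ is a primitive $q$-th root of unity, $q\geq 1$. For a periodic point $z$ of $F_k$ let $\langle z\rangle$ denote its cycle, regarded as a finite subset of $\widehat{\mathbb C}$; the period is the least one, and convergence of cycles to a closed subset of $\widehat{\mathbb C}$ is convergence in the Hausdorff (equivalently, Vietoris) sense. Then $\beta_k\to\bar\omega$. Moreover, let $n>1$ and let $\langle z_k\rangle$ be cycles of $F_k$ of period $n$ with $\langle z_k\rangle\to\{\infty\}$. Then $n=q$;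 and whenever $\langle \hat z_k\rangle$ are $q$-cycles of $F_k$ with $\langle\hat z_k\rangle\neq\langle z_k\rangle$ for all sufficiently large $k$ and $\langle\hat z_k\rangle$ converges to some closed set $\mathcal Z\subset\widehat{\mathbb C}$, one has $\mathcal Z=\{0,\infty\}$. -/

import Mathlib

open Filter Topology

noncomputable section

/-- The coordinate expression `γ z / (z² + δ z + 1)` of the quadratic family. -/
def quadFormula (γ δ z : ℂ) : ℂ := γ * z / (z ^ 2 + δ * z + 1)

open Classical in
/-- The rational map `F_{γ,δ}(z) = γ z / (z² + δ z + 1)` on the Riemann sphere `ℂ ∪ {∞}`.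
For `γ ≠ 0` the numerator and the denominator have no common zero, and the map has degree 2. -/
def quadMap (γ δ : ℂ) : OnePoint ℂ → OnePoint ℂ
  | none => ((0 : ℂ) : OnePoint ℂ)
  | some z => if z ^ 2 + δ * z + 1 = 0 then OnePoint.infty
      else ((quadFormula γ δ z : ℂ) : OnePoint ℂ)

/-- The unordered triple of fixed points of `F_{γ,δ}`, listed with multiplicity. The point `∞` is
never fixed; at a finite fixed point the denominator does not vanish (if `γ ≠ 0`), so that the
order of vanishing of `z - F_{γ,δ}(z)` is that of `z (z² + δ z + 1) - γ z`. -/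
def quadFix (γ δ : ℂ) : Multiset ℂ :=
  (Polynomial.X * (Polynomial.X ^ 2 + Polynomial.C δ * Polynomial.X + 1)
    - Polynomial.C γ * Polynomial.X : Polynomial ℂ).roots

/-- The eigenvalue of `F_{γ,δ}` at a finite fixed point `a`. -/
def quadEigenvalue (γ δ a : ℂ) : ℂ := deriv (quadFormula γ δ) a

/-- `z` is a periodic point of (least) period `n ≥ 1` of `g`. -/
def HasPeriod {X : Type*} (g : X → X) (n : ℕ) (z : X) : Prop :=
  0 < n ∧ Function.minimalPeriod g z = n

/-- The cycle `⟨z⟩ = {z, g z, …, g^{n-1} z}` of a periodic point `z`, as a set of points. -/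
def cycleSet {X : Type*} (g : X → X) (z : X) : Set X :=
  {w | w ∈ Function.periodicOrbit g z}

/-- The sets `S k` converge to the set `Z` as `k → ∞`, in the Vietoris topology. For closed subsets
of a compact metrizable space this is convergence in the Hausdorff distance. -/
def SetsTendTo {X : Type*} [TopologicalSpace X] (S : ℕ → Set X) (Z : Set X) : Prop :=
  Tendsto S atTop (@nhds (Set X) (TopologicalSpace.vietoris X) Z)

end

noncomputable section

namespace QuadraticCycles

open Finset

/-! ### First-order asymptotics of finite products. -/

section ProductLimits

variable {ι : Type*} {l : Filter ι}

/-! The fixed points determine the map: `γ = 1 - a b` and `δ = -(a + b)`. The hypotheses force `a, b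
→ ∞` with `a / b → ω`, which already gives the limit of the second eigenvalue. In the coordinate `w
= (z - a) / (z - b)` the map is `w ↦ (a / b) (1 + dev) w`. It converges to the rotation by `ω` away
from `w = ω`, the point where all finite `z` accumulate.

Along an escaping cycle `dev → 0`, so closing up forces `q ∣ n`. Comparing the orbit with its own
`q`-th shift (`ratio_succ`) gives `n = q` (`IsEscaping.eventually_periodic`).

Every `q`-cycle satisfies `(a / b) ^ q * ∏ (1 + dev) = 1`, where the first factor does not depend on
the cycle. Expanding to first order in two normalisations compares cycles. On the scale `b⁻¹ - a⁻¹`,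
an escaping cycle gives `0`, while a cycle with a point tending to `p ≠ 0` gives `-p⁻¹`; they cannot
coexist (`IsEscaping.not_tendsto`). So any other limit set lies in `{0, ∞}`.

If the limit omitted `0`, there would be two escaping cycles. On the finer scale `b⁻²` the quotient
has limit `-rotSum ω q x` when `w → x` with `x ^ q ≠ 1`, limit `-q` when `w → ∞`, and no finite
limit when `x ^ q = 1`. Hence both cycles accumulate on the same orbit of the rotation. A
Hurwitz-type count of the zeros of `rotQuot` excludes this off the pole (`false_of_zeros`), and a
direct comparison excludes it at the pole (`IsEscaping.false_of_poles`). If the limit omitted `∞`, a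
whole cycle would lie in the unit disc, where the map strictly increases the modulus. -/

theorem tendsto_prod_one_add {φ : ℕ → ι → ℂ} {n : ℕ}
    (hφ : ∀ i < n, Tendsto (φ i) l (𝓝 0)) :
    Tendsto (fun k => ∏ i ∈ range n, (1 + φ i k)) l (𝓝 1) := by
  have h : Tendsto (fun k => ∏ i ∈ range n, (1 + φ i k)) l (𝓝 (∏ i ∈ range n, (1 + 0 : ℂ))) :=
    tendsto_finsetProd _ fun i hi => (hφ i (mem_range.1 hi)).const_add 1
  simpa using h

theorem tendsto_prod_one_add_sub_one_div {φ : ℕ → ι → ℂ} {η : ι → ℂ} {p : ℕ → ℂ} {n : ℕ}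
    (hφ : ∀ i < n, Tendsto (φ i) l (𝓝 0))
    (h : ∀ i < n, Tendsto (fun k => φ i k / η k) l (𝓝 (p i))) :
    Tendsto (fun k => (∏ i ∈ range n, (1 + φ i k) - 1) / η k) l (𝓝 (∑ i ∈ range n, p i)) := by
  induction n with
  | zero => simpa using! tendsto_const_nhds
  | succ n ih =>
    have h1 := ih (fun i hi => hφ i (by omega)) (fun i hi => h i (by omega))
    have h2 := (tendsto_prod_one_add fun i hi => hφ i (Nat.lt_succ_of_lt hi)).mul (h n (by omega))
    rw [sum_range_succ]
    refine (h1.add (by simpa using h2)).congr fun k => ?_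
    rw [prod_range_succ]
    ring

/-- If `Λ ∏ (1 + φ i) = 1` with small `φ i` then `Λ - 1` is asymptotic to `-∑ φ i`. -/
theorem tendsto_sub_one_div_of_mul_prod_eq_one {φ : ℕ → ι → ℂ} {Λ η : ι → ℂ} {p : ℕ → ℂ} {n : ℕ}
    (hφ : ∀ i < n, Tendsto (φ i) l (𝓝 0))
    (h : ∀ i < n, Tendsto (fun k => φ i k / η k) l (𝓝 (p i)))
    (hΛ : ∀ᶠ k in l, Λ k * ∏ i ∈ range n, (1 + φ i k) = 1) :
    Tendsto (fun k => (Λ k - 1) / η k) l (𝓝 (-∑ i ∈ range n, p i)) := by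
  have h1 := tendsto_prod_one_add hφ
  have h2 := (tendsto_prod_one_add_sub_one_div hφ h).neg.div h1 one_ne_zero
  rw [div_one] at h2
  refine h2.congr' ?_
  filter_upwards [hΛ] with k hk
  have h0 : ∏ i ∈ range n, (1 + φ i k) ≠ 0 := right_ne_zero_of_mul_eq_one hk
  have hk' : Λ k = (∏ i ∈ range n, (1 + φ i k))⁻¹ := eq_inv_of_mul_eq_one_left hk
  simp only [Pi.div_apply]
  rw [hk', ← neg_div, div_div, mul_comm, ← div_div]
  congr 1
  field_simp
  ring

end ProductLimits

/-! ### Sums over the orbits of the limit rotation. -/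

section RootsOfUnity

variable {ω : ℂ} {q : ℕ}

/-- Each term is a geometric sum over the common denominator `1 - x ^ q`; summing over `j`,
orthogonality of characters kills every power except `m = 0`. -/
theorem sum_inv_one_sub_pow_mul (hω : IsPrimitiveRoot ω q) {x : ℂ} (hx : x ^ q ≠ 1) :
    ∑ j ∈ range q, (1 - ω ^ j * x)⁻¹ = q / (1 - x ^ q) := by
  have h1 : 1 - x ^ q ≠ 0 := sub_ne_zero.2 (Ne.symm hx)
  have hy : ∀ j, (ω ^ j * x) ^ q = x ^ q := fun j => by
    rw [mul_pow, ← pow_mul, mul_comm j, pow_mul, hω.pow_eq_one, one_pow, one_mul]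
  have key : ∀ j, (1 - ω ^ j * x)⁻¹ = (∑ m ∈ range q, (ω ^ j * x) ^ m) / (1 - x ^ q) := by
    intro j
    have h2 : 1 - ω ^ j * x ≠ 0 := by
      intro h
      apply hx
      rw [← hy j, ← sub_eq_zero.1 h, one_pow]
    rw [eq_div_iff h1, ← hy j, ← mul_neg_geom_sum, inv_mul_cancel_left₀ h2]
  rw [sum_congr rfl fun j _ => key j, ← sum_div, sum_comm]
  congr 1
  rcases Nat.eq_zero_or_pos q with rfl | hq
  · simp
  rw [sum_eq_single_of_mem 0 (mem_range.2 hq)]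
  · simp
  · intro m hm hm0
    have h3 : ω ^ m ≠ 1 := hω.pow_ne_one_of_pos_of_lt hm0 (mem_range.1 hm)
    have h4 : ∑ j ∈ range q, (ω ^ m) ^ j = 0 := by
      have := mul_neg_geom_sum (ω ^ m) q
      rw [← pow_mul, mul_comm m, pow_mul, hω.pow_eq_one, one_pow, sub_self] at this
      exact (mul_eq_zero.1 this).resolve_left (sub_ne_zero.2 (Ne.symm h3))
    calc ∑ j ∈ range q, (ω ^ j * x) ^ m = x ^ m * ∑ j ∈ range q, (ω ^ m) ^ j := by
          rw [mul_sum]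
          exact sum_congr rfl fun j _ => by rw [mul_pow]; ring
      _ = 0 := by rw [h4, mul_zero]

theorem pow_mul_pow_eq (hω : IsPrimitiveRoot ω q) (x : ℂ) (i : ℕ) : (ω ^ i * x) ^ q = x ^ q := by
  rw [mul_pow, ← pow_mul, mul_comm i, pow_mul, hω.pow_eq_one, one_pow, one_mul]

theorem sub_pow_mul_ne_zero (hω : IsPrimitiveRoot ω q) {x : ℂ} (hx : x ^ q ≠ 1) (i : ℕ) :
    ω - ω ^ i * x ≠ 0 := by
  intro h
  apply hx
  rw [← pow_mul_pow_eq hω x i, ← sub_eq_zero.1 h, hω.pow_eq_one]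

/-- The average of `(1 - w) / (ω - w)` over the rotates of `x`. -/
def rotSum (ω : ℂ) (q : ℕ) (x : ℂ) : ℂ := q + (ω⁻¹ - 1) * (q / (1 - x ^ q))

theorem sum_eq_rotSum (hq : 0 < q) (hω : IsPrimitiveRoot ω q) {x : ℂ} (hx : x ^ q ≠ 1) :
    ∑ j ∈ range q, (1 - ω ^ j * x) / (ω - ω ^ j * x) = rotSum ω q x := by
  have h0 : ω ≠ 0 := hω.ne_zero hq.ne'
  have hx' : (ω⁻¹ * x) ^ q ≠ 1 := by
    rw [mul_pow, inv_pow, hω.pow_eq_one, inv_one, one_mul]; exact hx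
  -- Splitting off the value at infinity reduces the sum to the previous one at `ω⁻¹ * x`, which has
  -- the same `q`-th power as `x`.
  have key : ∀ j, (1 - ω ^ j * x) / (ω - ω ^ j * x)
      = 1 + (ω⁻¹ - 1) * (1 - ω ^ j * (ω⁻¹ * x))⁻¹ := by
    intro j
    have h1 := sub_pow_mul_ne_zero hω hx j
    have h2 : 1 - ω ^ j * (ω⁻¹ * x) = ω⁻¹ * (ω - ω ^ j * x) := by field_simp
    rw [h2]
    field_simp
    ring
  rw [sum_congr rfl fun j _ => key j, sum_add_distrib, ← mul_sum,
    sum_inv_one_sub_pow_mul hω hx', mul_pow, inv_pow, hω.pow_eq_one, rotSum]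
  simp

end RootsOfUnity

/-! ### The map as a perturbed rotation. -/

/-- The relative deviation of `rotMap` from the rotation by `t`, up to the factor `c (1 - t⁻¹)`. -/
def rotDev (t c w : ℂ) : ℂ := (1 - w) / (t - w - c * (1 - w))

/-- The quadratic map in the coordinate where two of its fixed points are `0` and `∞`. -/
def rotMap (t c w : ℂ) : ℂ := t * w * (1 + c * (1 - t⁻¹) * rotDev t c w)

/-- `(f^q(w)/w - 1) / (c (1 - t⁻¹))` for `f = rotMap t c`. -/
def rotQuot (q : ℕ) (t c w : ℂ) : ℂ :=
  (t ^ q * ∏ i ∈ range q, (1 + c * (1 - t⁻¹) * rotDev t c ((rotMap t c)^[i] w)) - 1)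
    / (c * (1 - t⁻¹))

theorem rotMap_iterate (t c w : ℂ) (n : ℕ) : (rotMap t c)^[n] w
    = t ^ n * (∏ i ∈ range n, (1 + c * (1 - t⁻¹) * rotDev t c ((rotMap t c)^[i] w))) * w := by
  induction n with
  | zero => simp
  | succ n ih =>
    rw [Function.iterate_succ_apply', rotMap, prod_range_succ]
    nth_rw 1 [ih]
    ring

theorem rotQuot_eq_zero {q : ℕ} {t c w : ℂ} (hw : w ≠ 0) (h : (rotMap t c)^[q] w = w) :
    rotQuot q t c w = 0 := by
  rw [rotMap_iterate] at h
  rw [rotQuot, mul_right_cancel₀ hw (h.trans (one_mul w).symm), sub_self, zero_div]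

section RotLimits

variable {ι : Type*} {l : Filter ι} {ω : ℂ} {q : ℕ} {t c w : ι → ℂ} {x : ℂ}

theorem tendsto_rotDev (ht : Tendsto t l (𝓝 ω)) (hc : Tendsto c l (𝓝 0)) (hw : Tendsto w l (𝓝 x))
    (hx : ω - x ≠ 0) :
    Tendsto (fun k => rotDev (t k) (c k) (w k)) l (𝓝 ((1 - x) / (ω - x))) := by
  have h1 : Tendsto (fun k => 1 - w k) l (𝓝 (1 - x)) := hw.const_sub 1
  have h2 := (ht.sub hw).sub (hc.mul h1)
  rw [zero_mul, sub_zero] at h2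
  exact h1.div h2 hx

theorem tendsto_rotMap_iterate (hω0 : ω ≠ 0) (hω : IsPrimitiveRoot ω q) (ht : Tendsto t l (𝓝 ω))
    (hc : Tendsto c l (𝓝 0)) (hw : Tendsto w l (𝓝 x)) (hx : x ^ q ≠ 1) (i : ℕ) :
    Tendsto (fun k => (rotMap (t k) (c k))^[i] (w k)) l (𝓝 (ω ^ i * x)) := by
  induction i with
  | zero => simpa using hw
  | succ i ih =>
    have h1 := tendsto_rotDev ht hc ih (sub_pow_mul_ne_zero hω hx i)
    have h2 := (ht.mul ih).mul (((hc.mul ((ht.inv₀ hω0).const_sub 1)).mul h1).const_add 1)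
    simp only [zero_mul, add_zero, mul_one] at h2
    rw [pow_succ', mul_assoc]
    simp only [Function.iterate_succ_apply']
    exact h2

theorem tendsto_eta (hω0 : ω ≠ 0) (ht : Tendsto t l (𝓝 ω)) (hc : Tendsto c l (𝓝 0)) :
    Tendsto (fun k => c k * (1 - (t k)⁻¹)) l (𝓝 0) := by
  simpa using hc.mul ((ht.inv₀ hω0).const_sub 1)

theorem eventually_eta_ne_zero (hω0 : ω ≠ 0) (hω1 : ω ≠ 1) (ht : Tendsto t l (𝓝 ω))
    (hc0 : ∀ᶠ k in l, c k ≠ 0) : ∀ᶠ k in l, c k * (1 - (t k)⁻¹) ≠ 0 := by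
  have h := (ht.inv₀ hω0).eventually_ne (inv_ne_one.2 hω1)
  filter_upwards [h, hc0] with k h1 h2
  exact mul_ne_zero h2 (sub_ne_zero.2 (Ne.symm h1))

/-- The iterates of `w` converge to the rotates of `x`, which avoid the pole `ω` because `x ^ q ≠
1`; the first-order term is then the sum evaluated by `sum_eq_rotSum`. -/
theorem tendsto_rotQuot (hq : 0 < q) (hω : IsPrimitiveRoot ω q) (hω1 : ω ≠ 1)
    (ht : Tendsto t l (𝓝 ω)) (hc : Tendsto c l (𝓝 0)) (hc0 : ∀ᶠ k in l, c k ≠ 0)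
    (hw : Tendsto w l (𝓝 x)) (hx : x ^ q ≠ 1) {L : ℂ}
    (hL : Tendsto (fun k => (t k ^ q - 1) / (c k * (1 - (t k)⁻¹))) l (𝓝 L)) :
    Tendsto (fun k => rotQuot q (t k) (c k) (w k)) l (𝓝 (L + rotSum ω q x)) := by
  have hω0 : ω ≠ 0 := hω.ne_zero hq.ne'
  have hη := tendsto_eta hω0 ht hc
  have hd : ∀ i, Tendsto (fun k => rotDev (t k) (c k) ((rotMap (t k) (c k))^[i] (w k))) l
      (𝓝 ((1 - ω ^ i * x) / (ω - ω ^ i * x))) := fun i =>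
    tendsto_rotDev ht hc (tendsto_rotMap_iterate hω0 hω ht hc hw hx i) (sub_pow_mul_ne_zero hω hx i)
  have h1 := tendsto_prod_one_add_sub_one_div (n := q) (l := l)
    (φ := fun i k => c k * (1 - (t k)⁻¹) * rotDev (t k) (c k) ((rotMap (t k) (c k))^[i] (w k)))
    (η := fun k => c k * (1 - (t k)⁻¹)) (p := fun i => (1 - ω ^ i * x) / (ω - ω ^ i * x))
    (fun i _ => by simpa using hη.mul (hd i))
    (fun i _ => by
      refine (hd i).congr' ?_
      filter_upwards [eventually_eta_ne_zero hω0 hω1 ht hc0] with k hk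
      rw [mul_div_cancel_left₀ _ hk])
  rw [sum_eq_rotSum hq hω hx] at h1
  have h2 := hL.add ((ht.pow q).mul h1)
  rw [hω.pow_eq_one, one_mul] at h2
  refine h2.congr fun k => ?_
  rw [rotQuot]
  ring

end RotLimits

/-! ### Counting zeros of `rotQuot` near a limit point. -/

section Zeros

open Metric

/-- Zeros are divided out one at a time with `dslope`. Each division costs at most `2 / ρ`: by the
Schwarz lemma near the zero, and because `‖v - a‖ ≥ ρ / 2` elsewhere. The constant `4 / ρ` leaves
room. -/
theorem norm_le_prod_zeros {x : ℂ} {ρ : ℝ} (hρ : 0 < ρ) (s : Finset ℂ) :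
    ∀ {f : ℂ → ℂ} {M : ℝ}, DifferentiableOn ℂ f (ball x ρ) → (∀ w ∈ ball x ρ, ‖f w‖ ≤ M) →
      (∀ j ∈ s, j ∈ ball x (ρ / 2)) → (∀ j ∈ s, f j = 0) →
      ∀ w ∈ ball x ρ, ‖f w‖ ≤ M * (4 / ρ) ^ s.card * ∏ j ∈ s, ‖w - j‖ := by
  induction s using Finset.induction_on with
  | empty => intro f M _ hM _ _ w hw; simpa using hM w hw
  | insert a s ha ih =>
    intro f M hf hM hs h0 w hw
    have haρ : a ∈ ball x (ρ / 2) := hs a (mem_insert_self _ _)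
    have haρ' : a ∈ ball x ρ := ball_subset_ball (by linarith) haρ
    have hfa : f a = 0 := h0 a (mem_insert_self _ _)
    have hM0 : 0 ≤ M := (norm_nonneg _).trans (hM a haρ')
    have hg : DifferentiableOn ℂ (dslope f a) (ball x ρ) :=
      (Complex.differentiableOn_dslope (isOpen_ball.mem_nhds haρ')).2 hf
    have hsub : ball a (ρ / 2) ⊆ ball x ρ := by
      apply ball_subset_ball'
      rw [mem_ball] at haρ
      linarith
    have hfact : ∀ v, f v = (v - a) * dslope f a v := fun v => by
      have := sub_smul_dslope f a v
      rw [hfa, sub_zero, smul_eq_mul] at this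
      exact this.symm
    have hgM : ∀ v ∈ ball x ρ, ‖dslope f a v‖ ≤ M * (4 / ρ) := by
      intro v hv
      by_cases hva : v ∈ ball a (ρ / 2)
      · have := Complex.norm_dslope_le_div_of_mapsTo_ball (R₂ := M) (hf.mono hsub)
          (fun u hu => by simpa [hfa] using hM u (hsub hu)) hva
        refine this.trans ?_
        rw [div_le_iff₀ (by positivity)]
        have : M * (4 / ρ) * (ρ / 2) = 2 * M := by field_simp; norm_num
        linarith
      · have h1 : ρ / 2 ≤ ‖v - a‖ := by
          rw [mem_ball, dist_eq_norm] at hva; linarith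
        have h2 := hM v hv
        rw [hfact v, norm_mul] at h2
        have h3 : ρ / 2 * ‖dslope f a v‖ ≤ M :=
          (mul_le_mul_of_nonneg_right h1 (norm_nonneg _)).trans h2
        rw [← mul_div_assoc, le_div_iff₀ hρ]
        nlinarith [norm_nonneg (dslope f a v)]
    have h := ih hg hgM (fun j hj => hs j (mem_insert_of_mem hj)) (fun j hj => by
      have h1 := h0 j (mem_insert_of_mem hj)
      rw [hfact j] at h1
      exact (mul_eq_zero.1 h1).resolve_left (sub_ne_zero.2 (by rintro rfl; exact ha hj))) w hw
    rw [hfact w, norm_mul, prod_insert ha, card_insert_of_notMem ha, pow_succ]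
    calc ‖w - a‖ * ‖dslope f a w‖
        ≤ ‖w - a‖ * (M * (4 / ρ) * (4 / ρ) ^ s.card * ∏ j ∈ s, ‖w - j‖) := by gcongr
      _ = _ := by ring

/-- Turns limits along convergent sequences into uniform statements on a compact set:
counterexamples converge along the ultrafilter. -/
theorem eventually_forall_of_compact {ι : Type*} {U : Ultrafilter ι} {K : Set ℂ} (hK : IsCompact K)
    {P : ι → ℂ → Prop}
    (h : ∀ w : ι → ℂ, ∀ y ∈ K, Tendsto w U (𝓝 y) → ∀ᶠ k in (U : Filter ι), P k (w k)) :
    ∀ᶠ k in (U : Filter ι), ∀ w ∈ K, P k w := by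
  by_contra hcon
  rw [← Ultrafilter.eventually_not] at hcon
  have h1 : ∀ k, ∃ w, (¬ ∀ w ∈ K, P k w) → w ∈ K ∧ ¬ P k w := fun k => by
    by_cases hk : ∀ w ∈ K, P k w
    · exact ⟨0, fun h => absurd hk h⟩
    · push Not at hk
      obtain ⟨w, hw⟩ := hk
      exact ⟨w, fun _ => hw⟩
  choose w hw using h1
  obtain ⟨y, hy, hlim⟩ := hK.ultrafilter_le_nhds (U.map w) (by
    rw [le_principal_iff]
    exact hcon.mono fun k hk => (hw k hk).1)
  obtain ⟨k, hk1, hk2⟩ := ((h w y hy hlim).and hcon).exists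
  exact (hw k hk2).2 hk1

theorem differentiableAt_rotQuot {q : ℕ} {t c w : ℂ}
    (h : ∀ i < q, t - (rotMap t c)^[i] w - c * (1 - (rotMap t c)^[i] w) ≠ 0) :
    DifferentiableAt ℂ (rotQuot q t c) w := by
  have hdev : ∀ v, t - v - c * (1 - v) ≠ 0 → DifferentiableAt ℂ (rotDev t c) v := fun v hv => by
    unfold rotDev
    fun_prop (disch := assumption)
  have hit : ∀ i ≤ q, DifferentiableAt ℂ (rotMap t c)^[i] w := by
    intro i hi
    induction i with
    | zero => exact differentiableAt_id
    | succ i ih =>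
      rw [Function.iterate_succ']
      refine DifferentiableAt.comp w ?_ (ih (by omega))
      have := hdev _ (h i (by omega))
      unfold rotMap
      fun_prop
  have hp : ∀ i ∈ range q, DifferentiableAt ℂ
      (fun v => 1 + c * (1 - t⁻¹) * rotDev t c ((rotMap t c)^[i] v)) w := fun i hi => by
    have hi := mem_range.1 hi
    have := (hdev _ (h i hi)).comp w (hit i hi.le)
    exact (this.const_mul _).const_add _
  unfold rotQuot
  exact (((DifferentiableAt.fun_finsetProd hp).const_mul _).sub_const _).div_const _

variable {ι : Type*} {U : Ultrafilter ι} {ω : ℂ} {q : ℕ} {t c : ι → ℂ} {x : ℂ}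

/-- Zeros of `rotQuot` accumulating at `x` force the limit function to vanish at `x`. -/
theorem exists_norm_le_of_zeros (hq : 0 < q) (hω : IsPrimitiveRoot ω q) (hω1 : ω ≠ 1)
    (ht : Tendsto t U (𝓝 ω)) (hc : Tendsto c U (𝓝 0)) (hc0 : ∀ᶠ k in (U : Filter ι), c k ≠ 0)
    (hx : x ^ q ≠ 1) {L : ℂ}
    (hL : Tendsto (fun k => (t k ^ q - 1) / (c k * (1 - (t k)⁻¹))) U (𝓝 L))
    {s : ι → Finset ℂ} {N : ℕ} (hs : ∀ ε > 0, ∀ᶠ k in (U : Filter ι), ∀ j ∈ s k, j ∈ ball x ε)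
    (hs0 : ∀ᶠ k in (U : Filter ι), ∀ j ∈ s k, rotQuot q (t k) (c k) j = 0)
    (hN : ∀ᶠ k in (U : Filter ι), (s k).card = N) :
    ∃ C : ℝ, ∃ ρ > 0, ∀ w ∈ ball x ρ, ‖L + rotSum ω q w‖ ≤ C * ‖w - x‖ ^ N := by
  have hω0 : ω ≠ 0 := hω.ne_zero hq.ne'
  have hopen : IsOpen {w : ℂ | w ^ q ≠ 1} := isOpen_ne_fun (by fun_prop) (by fun_prop)
  obtain ⟨ρ, hρ, hsub⟩ := Metric.nhds_basis_closedBall.mem_iff.1 (hopen.mem_nhds hx)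
  have hK := isCompact_closedBall x ρ
  have hcont : ContinuousOn (fun w => L + rotSum ω q w) (closedBall x ρ) := by
    unfold rotSum
    refine continuousOn_const.add (continuousOn_const.add (continuousOn_const.mul
      (continuousOn_const.div (by fun_prop) fun w hw => ?_)))
    exact sub_ne_zero.2 (Ne.symm (hsub hw))
  obtain ⟨M, hM⟩ := hK.exists_bound_of_continuousOn hcont
  have hbd : ∀ᶠ k in (U : Filter ι), ∀ w ∈ closedBall x ρ, ‖rotQuot q (t k) (c k) w‖ ≤ M + 1 := by
    refine eventually_forall_of_compact hK fun w y hy hw => ?_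
    have h1 := (tendsto_rotQuot hq hω hω1 ht hc hc0 hw (hsub hy) hL).norm
    exact (h1.eventually (gt_mem_nhds (lt_of_le_of_lt (hM y hy) (lt_add_one M)))).mono
      fun k hk => hk.le
  have hden : ∀ᶠ k in (U : Filter ι), ∀ w ∈ closedBall x ρ, ∀ i < q,
      t k - (rotMap (t k) (c k))^[i] w - c k * (1 - (rotMap (t k) (c k))^[i] w) ≠ 0 := by
    refine eventually_forall_of_compact hK fun w y hy hw => ?_
    have hi : ∀ i ∈ Set.Iio q, ∀ᶠ k in (U : Filter ι),
        t k - (rotMap (t k) (c k))^[i] (w k) - c k * (1 - (rotMap (t k) (c k))^[i] (w k)) ≠ 0 := by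
      intro i _
      have h1 := tendsto_rotMap_iterate hω0 hω ht hc hw (hsub hy) i
      have h2 := (ht.sub h1).sub (hc.mul (h1.const_sub 1))
      rw [zero_mul, sub_zero] at h2
      exact h2.eventually_ne (sub_pow_mul_ne_zero hω (hsub hy) i)
    exact (eventually_all_finite (Set.finite_Iio q)).2 hi
  refine ⟨(M + 1) * (4 / ρ) ^ N, ρ, hρ, fun w hw => ?_⟩
  have hlim := (tendsto_rotQuot hq hω hω1 ht hc hc0 (tendsto_const_nhds (x := w) (f := (U : Filter ι)))
    (hsub (ball_subset_closedBall hw)) hL).norm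
  -- The zeros only converge to `x`, hence the slack `ε`, removed at the end by continuity.
  have hbound : ∀ ε > 0, ‖L + rotSum ω q w‖ ≤ (M + 1) * (4 / ρ) ^ N * (‖w - x‖ + ε) ^ N := by
    intro ε hε
    refine le_of_tendsto hlim ?_
    filter_upwards [hbd, hden, hs (ρ / 2) (by positivity), hs ε hε, hs0, hN] with k h1 h2 h3 h4 h5 h6
    have h7 := norm_le_prod_zeros hρ (s k) (f := rotQuot q (t k) (c k)) (M := M + 1)
      (fun v hv => (differentiableAt_rotQuot
        (h2 v (ball_subset_closedBall hv))).differentiableWithinAt)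
      (fun v hv => h1 v (ball_subset_closedBall hv)) h3 h5 w hw
    have hM0 : 0 ≤ M + 1 := (norm_nonneg _).trans (h1 w (ball_subset_closedBall hw))
    rw [h6] at h7
    refine h7.trans (mul_le_mul_of_nonneg_left ?_ (by positivity))
    rw [← h6, ← prod_const]
    refine prod_le_prod (fun _ _ => norm_nonneg _) fun j hj => ?_
    have h8 := h4 j hj
    rw [mem_ball, dist_eq_norm] at h8
    calc ‖w - j‖ = ‖(w - x) - (j - x)‖ := by congr 1; ring
      _ ≤ ‖w - x‖ + ‖j - x‖ := norm_sub_le _ _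
      _ ≤ _ := by linarith
  have hcontε : Tendsto (fun ε : ℝ => (M + 1) * (4 / ρ) ^ N * (‖w - x‖ + ε) ^ N) (𝓝[>] 0)
      (𝓝 ((M + 1) * (4 / ρ) ^ N * (‖w - x‖ + 0) ^ N)) :=
    ((by fun_prop : Continuous fun ε : ℝ => (M + 1) * (4 / ρ) ^ N * (‖w - x‖ + ε) ^ N).tendsto
      0).mono_left nhdsWithin_le_nhds
  rw [add_zero] at hcontε
  exact ge_of_tendsto hcontε (eventually_mem_nhdsWithin.mono fun ε hε => hbound ε hε)

/-- `rotQuot` cannot have more zeros near `x` than `w ^ q - x ^ q` has. -/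
theorem false_of_zeros (hq : 0 < q) (hω : IsPrimitiveRoot ω q) (hω1 : ω ≠ 1)
    (ht : Tendsto t U (𝓝 ω)) (hc : Tendsto c U (𝓝 0)) (hc0 : ∀ᶠ k in (U : Filter ι), c k ≠ 0)
    (hx : x ^ q ≠ 1) {L : ℂ}
    (hL : Tendsto (fun k => (t k ^ q - 1) / (c k * (1 - (t k)⁻¹))) U (𝓝 L))
    {s : ι → Finset ℂ} {N : ℕ} (hs : ∀ ε > 0, ∀ᶠ k in (U : Filter ι), ∀ j ∈ s k, j ∈ ball x ε)
    (hs0 : ∀ᶠ k in (U : Filter ι), ∀ j ∈ s k, rotQuot q (t k) (c k) j = 0)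
    (hN : ∀ᶠ k in (U : Filter ι), (s k).card = N) (hN2 : 2 ≤ N) (hNq : x = 0 → q < N) : False := by
  obtain ⟨C, ρ, hρ, hb⟩ := exists_norm_le_of_zeros hq hω hω1 ht hc hc0 hx hL hs hs0 hN
  have hx0 : L + rotSum ω q x = 0 := by
    have := hb x (mem_ball_self hρ)
    rwa [sub_self, norm_zero, zero_pow (by omega), mul_zero, norm_le_zero_iff] at this
  have hω0 : ω ≠ 0 := hω.ne_zero hq.ne'
  have hq0 : (q : ℂ) ≠ 0 := Nat.cast_ne_zero.2 hq.ne'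
  have hK : (ω⁻¹ - 1) * (q : ℂ) ≠ 0 := mul_ne_zero (sub_ne_zero.2 (inv_ne_one.2 hω1)) hq0
  have hx1 : 1 - x ^ q ≠ 0 := sub_ne_zero.2 (Ne.symm hx)
  have hO : (fun w => w ^ q - x ^ q) =O[𝓝 x] fun w => (w - x) ^ N := by
    have h1 : (fun w => L + rotSum ω q w) =O[𝓝 x] fun w => (w - x) ^ N := by
      refine Asymptotics.IsBigO.of_bound C ?_
      filter_upwards [ball_mem_nhds x hρ] with w hw
      rw [norm_pow]
      exact hb w hw
    have h2 : (fun w => (1 - w ^ q) * (1 - x ^ q) / ((ω⁻¹ - 1) * q)) =O[𝓝 x] fun _ => (1 : ℂ) :=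
      (Continuous.tendsto (by fun_prop) x).isBigO_one ℂ
    refine (h1.mul h2).congr' ?_ (by simp)
    have hopen : IsOpen {w : ℂ | w ^ q ≠ 1} := isOpen_ne_fun (by fun_prop) (by fun_prop)
    filter_upwards [hopen.mem_nhds hx] with w hw
    have hw1 : 1 - w ^ q ≠ 0 := sub_ne_zero.2 (Ne.symm hw)
    have hLe : L = -rotSum ω q x := eq_neg_of_add_eq_zero_left hx0
    -- Since `L = -rotSum ω q x`, the limit function is `w ^ q - x ^ q` times a nonvanishing factor
    -- near `x`.
    have h3 : L + rotSum ω q w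
        = (ω⁻¹ - 1) * q * (w ^ q - x ^ q) / ((1 - w ^ q) * (1 - x ^ q)) := by
      rw [hLe, rotSum, rotSum]
      generalize ω⁻¹ - 1 = κ
      field_simp
      ring
    rw [h3]
    field_simp
  by_cases hxz : x = 0
  · subst hxz
    simp only [sub_zero, zero_pow hq.ne'] at hO
    have h1 := hO.trans_isLittleO (Asymptotics.isLittleO_pow_pow (𝕜 := ℂ) (hNq rfl))
    have h2 : ∃ᶠ w in 𝓝 (0 : ℂ), w ^ q ≠ 0 := by
      have h3 : ∀ᶠ w in 𝓝[≠] (0 : ℂ), w ^ q ≠ 0 :=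
        eventually_mem_nhdsWithin.mono fun w hw => pow_ne_zero q hw
      have : ∃ᶠ w in 𝓝[≠] (0 : ℂ), w ^ q ≠ 0 := h3.frequently
      exact this.filter_mono nhdsWithin_le_nhds
    exact Asymptotics.isLittleO_irrefl h2 h1
  -- At `x ≠ 0` two zeros would make the derivative `q x ^ (q - 1)` vanish.
  · have h1 : (fun w => w ^ q - x ^ q) =o[𝓝 x] fun w => w - x := by
      refine hO.trans_isLittleO ?_
      have h3 : Tendsto (fun w : ℂ => w - x) (𝓝 x) (𝓝 0) := by
        simpa using (continuous_sub_right x).tendsto x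
      have h4 := (Asymptotics.isLittleO_pow_pow (𝕜 := ℂ) (show 1 < N by omega)).comp_tendsto h3
      simpa [Function.comp_def] using h4
    have h2 : HasDerivAt (fun w : ℂ => w ^ q) 0 x := by
      rw [hasDerivAt_iff_isLittleO]
      simpa using h1
    have h3 := (hasDerivAt_pow q x).unique h2
    exact mul_ne_zero hq0 (pow_ne_zero _ hxz) h3

end Zeros

/-! ### Finite orbits in the coordinate `coord a b`. -/

/-- Nondegeneracy of the nonzero fixed points `a`, `b` of the quadratic map with `γ = 1 - a b`. -/
structure Admissible (a b : ℂ) : Prop where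
  left_ne_zero : a ≠ 0
  right_ne_zero : b ≠ 0
  ne : a ≠ b
  mult_ne_zero : 1 - a * b ≠ 0

/-- A finite orbit, of period dividing `n` and avoiding the fixed points, of the quadratic map with
fixed points `0`, `a`, `b`. -/
structure IsOrbit (a b : ℂ) (n : ℕ) (z : ℕ → ℂ) : Prop where
  ne_zero : ∀ i, z i ≠ 0
  ne_left : ∀ i, z i ≠ a
  ne_right : ∀ i, z i ≠ b
  step : ∀ i, z (i + 1) * (z i ^ 2 - (a + b) * z i + 1) = (1 - a * b) * z i
  periodic : ∀ i, z (i + n) = z i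

/-- The coordinate with `a ↦ 0` and `b ↦ ∞`. -/
def coord (a b z : ℂ) : ℂ := (z - a) / (z - b)

/-- The deviation of the map from the rotation by `a / b`, in the coordinate `coord a b`. -/
def dev (a b z : ℂ) : ℂ := (b⁻¹ - a⁻¹) / (z - b⁻¹)

/-- The coefficient controlling how the ratio of the coordinates of two points changes. -/
def pairDev (a b z z' : ℂ) : ℂ := (z' - b) * (z - a) / ((1 - b * z') * (1 - a * z))

section Orbit

variable {a b : ℂ} {n : ℕ} {z z' : ℕ → ℂ}

theorem Admissible.symm (h : Admissible a b) : Admissible b a :=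
  ⟨h.2, h.1, h.3.symm, by rw [mul_comm]; exact h.4⟩

theorem IsOrbit.symm (h : IsOrbit a b n z) : IsOrbit b a n z :=
  ⟨h.1, h.3, h.2, fun i => by rw [add_comm b a, mul_comm b a]; exact h.step i, h.5⟩

theorem IsOrbit.shift (h : IsOrbit a b n z) (s : ℕ) : IsOrbit a b n (fun i => z (i + s)) :=
  ⟨fun i => h.1 _, fun i => h.2 _, fun i => h.3 _,
    fun i => by rw [add_right_comm i 1 s]; exact h.step _,
    fun i => by rw [add_right_comm i n s]; exact h.periodic _⟩

theorem coord_inv (a b z : ℂ) : (coord a b z)⁻¹ = coord b a z := inv_div _ _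

theorem coord_injective (hab : a ≠ b) {u v : ℂ} (hu : u ≠ b) (hv : v ≠ b)
    (h : coord a b u = coord a b v) : u = v := by
  rw [coord, coord, div_eq_div_iff (sub_ne_zero.2 hu) (sub_ne_zero.2 hv)] at h
  have h1 : (a - b) * (u - v) = 0 := by linear_combination h
  exact sub_eq_zero.1 ((mul_eq_zero.1 h1).resolve_left (sub_ne_zero.2 hab))

theorem IsOrbit.coord_ne_zero (h : IsOrbit a b n z) (i : ℕ) : coord a b (z i) ≠ 0 :=
  div_ne_zero (sub_ne_zero.2 (h.ne_left i)) (sub_ne_zero.2 (h.ne_right i))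

theorem IsOrbit.den_ne_zero (hab : Admissible a b) (h : IsOrbit a b n z) (i : ℕ) :
    z i ^ 2 - (a + b) * z i + 1 ≠ 0 := fun h0 => by
  have := h.step i
  rw [h0, mul_zero] at this
  exact mul_ne_zero hab.4 (h.ne_zero i) this.symm

theorem IsOrbit.one_sub_mul_ne_zero (hab : Admissible a b) (h : IsOrbit a b n z) (i : ℕ) :
    1 - b * z i ≠ 0 := fun h0 => by
  have h1 : (z (i + 1) - b) * (z i ^ 2 - (a + b) * z i + 1) = (z i - b) * (1 - b * z i) := by
    linear_combination h.step i
  rw [h0, mul_zero] at h1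
  exact mul_ne_zero (sub_ne_zero.2 (h.ne_right _)) (h.den_ne_zero hab i) h1

theorem IsOrbit.sub_inv_ne_zero (hab : Admissible a b) (h : IsOrbit a b n z) (i : ℕ) :
    z i - b⁻¹ ≠ 0 := fun h0 => by
  apply h.one_sub_mul_ne_zero hab i
  rw [sub_eq_zero.1 h0, mul_inv_cancel₀ hab.2, sub_self]

theorem IsOrbit.coord_succ (hab : Admissible a b) (h : IsOrbit a b n z) (i : ℕ) :
    coord a b (z (i + 1)) = coord a b (z i) * ((1 - a * z i) / (1 - b * z i)) := by
  have hD := h.den_ne_zero hab i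
  have h1 : (z (i + 1) - b) * (z i ^ 2 - (a + b) * z i + 1) = (z i - b) * (1 - b * z i) := by
    linear_combination h.step i
  have h2 : (z (i + 1) - a) * (z i ^ 2 - (a + b) * z i + 1) = (z i - a) * (1 - a * z i) := by
    linear_combination h.step i
  rw [coord, coord, div_mul_div_comm, ← h1, ← h2, mul_div_mul_right _ _ hD]

theorem IsOrbit.coord_succ' (hab : Admissible a b) (h : IsOrbit a b n z) (i : ℕ) :
    coord a b (z (i + 1)) = a / b * (1 + dev a b (z i)) * coord a b (z i) := by
  rw [h.coord_succ hab, mul_comm]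
  congr 1
  have h1 := h.one_sub_mul_ne_zero hab i
  have h2 := h.sub_inv_ne_zero hab i
  have ha := hab.1
  have hb := hab.2
  have h3 : z i - b⁻¹ = -(1 - b * z i) / b := by field_simp; ring
  rw [dev, h3]
  obtain ⟨D, hD⟩ : ∃ D, D = 1 - b * z i := ⟨_, rfl⟩
  rw [← hD] at h1 ⊢
  field_simp
  rw [hD]
  ring

theorem IsOrbit.coord_add (hab : Admissible a b) (h : IsOrbit a b n z) (i m : ℕ) :
    coord a b (z (i + m))
      = (a / b) ^ m * (∏ j ∈ range m, (1 + dev a b (z (i + j)))) * coord a b (z i) := by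
  induction m with
  | zero => simp
  | succ m ih =>
    rw [← add_assoc, h.coord_succ' hab, ih, prod_range_succ]
    ring

/-- The nonzero coordinate returns to itself after `n` steps. This closing equation is what all
cycles are compared through. -/
theorem IsOrbit.prod_eq_one (hab : Admissible a b) (h : IsOrbit a b n z) :
    (a / b) ^ n * ∏ i ∈ range n, (1 + dev a b (z i)) = 1 := by
  have h1 := h.coord_add hab 0 n
  rw [h.periodic] at h1
  simp only [zero_add] at h1
  exact mul_right_cancel₀ (h.coord_ne_zero 0) (h1.symm.trans (one_mul _).symm)

/-- Links the two normalisations: `dev` is of size `b⁻¹ - a⁻¹` when `z` is followed, and of size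
`b⁻²` when `w` is followed away from the pole. -/
theorem IsOrbit.dev_eq (hab : Admissible a b) (h : IsOrbit a b n z) (i : ℕ) :
    dev a b (z i) = (b ^ 2)⁻¹ * (1 - (a / b)⁻¹) * rotDev (a / b) (b ^ 2)⁻¹ (coord a b (z i)) := by
  have h1 := h.one_sub_mul_ne_zero hab i
  have ha := hab.1
  have hb := hab.2
  have h4 : a - b ≠ 0 := sub_ne_zero.2 hab.3
  have h5 := sub_ne_zero.2 (h.ne_right i)
  have h3 : z i - b⁻¹ = -(1 - b * z i) / b := by field_simp; ring
  have h6 : 1 - coord a b (z i) = (a - b) / (z i - b) := by rw [coord]; field_simp; ring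
  have h7 : a / b - coord a b (z i) - (b ^ 2)⁻¹ * (1 - coord a b (z i))
      = -(a - b) * (1 - b * z i) / (b ^ 2 * (z i - b)) := by rw [h6, coord]; field_simp; ring
  rw [dev, rotDev, h7, h6, h3]
  field_simp

theorem IsOrbit.coord_succ_eq_rotMap (hab : Admissible a b) (h : IsOrbit a b n z) (i : ℕ) :
    coord a b (z (i + 1)) = rotMap (a / b) (b ^ 2)⁻¹ (coord a b (z i)) := by
  rw [h.coord_succ' hab, h.dev_eq hab, rotMap]
  ring

theorem IsOrbit.coord_add_eq_rotMap_iterate (hab : Admissible a b) (h : IsOrbit a b n z)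
    (i m : ℕ) : coord a b (z (i + m)) = (rotMap (a / b) (b ^ 2)⁻¹)^[m] (coord a b (z i)) := by
  induction m with
  | zero => rfl
  | succ m ih => rw [← add_assoc, h.coord_succ_eq_rotMap hab, ih, Function.iterate_succ_apply']

theorem IsOrbit.rotQuot_eq_zero (hab : Admissible a b) (h : IsOrbit a b n z) (i : ℕ) :
    rotQuot n (a / b) (b ^ 2)⁻¹ (coord a b (z i)) = 0 := by
  apply QuadraticCycles.rotQuot_eq_zero (h.coord_ne_zero i)
  rw [← h.coord_add_eq_rotMap_iterate hab, h.periodic]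

/-- The ratio of the coordinates of two points. -/
def ratio (a b z z' : ℂ) : ℂ := coord a b z' / coord a b z

/-- The ratio is `1` exactly when the two points agree, so `ratio - 1` evolves multiplicatively,
with a factor close to `1` when `ratio * pairDev` is small. -/
theorem ratio_succ {m : ℕ} (hab : Admissible a b) (h : IsOrbit a b n z) (h' : IsOrbit a b m z')
    (i : ℕ) : ratio a b (z (i + 1)) (z' (i + 1)) - 1
      = (ratio a b (z i) (z' i) - 1) *
        (1 + -(ratio a b (z i) (z' i) * pairDev a b (z i) (z' i))) := by
  have h1 := h.one_sub_mul_ne_zero hab i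
  have h2 := h'.one_sub_mul_ne_zero hab i
  have h3 := h.symm.one_sub_mul_ne_zero hab.symm i
  have h4 := h'.symm.one_sub_mul_ne_zero hab.symm i
  have h5 := sub_ne_zero.2 (h.ne_right i)
  have h6 := sub_ne_zero.2 (h'.ne_right i)
  have h7 := sub_ne_zero.2 (h.ne_left i)
  have h8 := sub_ne_zero.2 (h'.ne_left i)
  rw [ratio, h.coord_succ hab, h'.coord_succ hab, ratio, pairDev, coord, coord]
  generalize z i = u at *
  generalize z' i = v at *
  obtain ⟨D, hD⟩ : ∃ D, D = 1 - b * v := ⟨_, rfl⟩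
  obtain ⟨E, hE⟩ : ∃ E, E = 1 - a * u := ⟨_, rfl⟩
  obtain ⟨G, hG⟩ : ∃ G, G = 1 - b * u := ⟨_, rfl⟩
  obtain ⟨K, hK⟩ : ∃ K, K = 1 - a * v := ⟨_, rfl⟩
  rw [← hG] at h1 ⊢
  rw [← hD] at h2 ⊢
  rw [← hE] at h3 ⊢
  rw [← hK] at h4 ⊢
  field_simp
  rw [hD, hE, hG, hK]
  ring

theorem ratio_eq_prod {m : ℕ} (hab : Admissible a b) (h : IsOrbit a b n z)
    (h' : IsOrbit a b m z') (i : ℕ) : ratio a b (z i) (z' i) - 1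
      = (ratio a b (z 0) (z' 0) - 1) *
        ∏ j ∈ range i, (1 + -(ratio a b (z j) (z' j) * pairDev a b (z j) (z' j))) := by
  induction i with
  | zero => simp
  | succ i ih => rw [ratio_succ hab h h', ih, prod_range_succ, mul_assoc]

end Orbit

/-- Parameters tending to infinity such that the eigenvalues of two fixed points tend to `ω`, `ω⁻¹`. -/
structure IsLimitParam (l : Filter ℕ) (a b : ℕ → ℂ) (ω : ℂ) : Prop where
  admissible : ∀ᶠ k in l, Admissible (a k) (b k)
  tendsto_div : Tendsto (fun k => a k / b k) l (𝓝 ω)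
  tendsto_inv : Tendsto (fun k => (b k)⁻¹) l (𝓝 0)

/-! ### Escaping orbits and their period. -/

section Limits

variable {l : Filter ℕ} {a b : ℕ → ℂ} {ω : ℂ} {n q : ℕ} {z z' : ℕ → ℕ → ℂ}

theorem IsLimitParam.mono {l' : Filter ℕ} (h : IsLimitParam l a b ω) (hl : l' ≤ l) :
    IsLimitParam l' a b ω := ⟨hl h.1, h.2.mono_left hl, h.3.mono_left hl⟩

theorem IsLimitParam.tendsto_inv_left (h : IsLimitParam l a b ω) (hω : ω ≠ 0) :
    Tendsto (fun k => (a k)⁻¹) l (𝓝 0) := by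
  have h1 := (h.2.inv₀ hω).mul h.3
  rw [mul_zero] at h1
  refine h1.congr' (h.1.mono fun k hk => ?_)
  have := hk.1
  have := hk.2
  field_simp

theorem IsLimitParam.symm (h : IsLimitParam l a b ω) (hω : ω ≠ 0) :
    IsLimitParam l b a ω⁻¹ :=
  ⟨h.1.mono fun _ hk => hk.symm, (h.2.inv₀ hω).congr fun _ => inv_div _ _, h.tendsto_inv_left hω⟩

theorem IsLimitParam.tendsto_c (h : IsLimitParam l a b ω) :
    Tendsto (fun k => (b k ^ 2)⁻¹) l (𝓝 0) := by
  simpa [inv_pow] using h.3.pow 2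

theorem IsLimitParam.c_ne_zero (h : IsLimitParam l a b ω) : ∀ᶠ k in l, (b k ^ 2)⁻¹ ≠ 0 :=
  h.1.mono fun _ hk => inv_ne_zero (pow_ne_zero _ hk.2)

theorem IsLimitParam.tendsto_kappa (h : IsLimitParam l a b ω) (hω : ω ≠ 0) :
    Tendsto (fun k => (b k)⁻¹ - (a k)⁻¹) l (𝓝 0) := by
  simpa using h.3.sub (h.tendsto_inv_left hω)

theorem IsLimitParam.kappa_ne_zero (h : IsLimitParam l a b ω) :
    ∀ᶠ k in l, (b k)⁻¹ - (a k)⁻¹ ≠ 0 :=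
  h.1.mono fun _ hk => sub_ne_zero.2 fun h => hk.3 (inv_injective h).symm

/-- `dev` divided by `b⁻¹ - a⁻¹` tends to `z⁻¹`. -/
theorem IsLimitParam.tendsto_dev_div (h : IsLimitParam l a b ω) {z : ℕ → ℂ} {p : ℂ}
    (hz0 : ∀ᶠ k in l, z k ≠ 0) (hz : Tendsto (fun k => (z k)⁻¹) l (𝓝 p)) :
    Tendsto (fun k => dev (a k) (b k) (z k) / ((b k)⁻¹ - (a k)⁻¹)) l (𝓝 p) := by
  have h1 := hz.div ((hz.mul h.3).const_sub 1) (by simp)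
  simp only [mul_zero, sub_zero, div_one] at h1
  refine h1.congr' ?_
  filter_upwards [h.1, h.kappa_ne_zero, hz0] with k h2 h3 h4
  rw [dev, div_right_comm, div_self h3]
  simp only [Pi.div_apply]
  rw [div_eq_mul_inv, ← mul_inv, one_div]
  congr 1
  field_simp

theorem IsLimitParam.tendsto_dev (h : IsLimitParam l a b ω) (hω : ω ≠ 0) {z : ℕ → ℂ} {p : ℂ}
    (hz0 : ∀ᶠ k in l, z k ≠ 0) (hz : Tendsto (fun k => (z k)⁻¹) l (𝓝 p)) :
    Tendsto (fun k => dev (a k) (b k) (z k)) l (𝓝 0) := by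
  have h1 := (h.tendsto_kappa hω).mul (h.tendsto_dev_div hz0 hz)
  rw [zero_mul] at h1
  exact h1.congr' (h.kappa_ne_zero.mono fun k hk => mul_div_cancel₀ _ hk)

theorem IsLimitParam.tendsto_pairDev (h : IsLimitParam l a b ω) (hω : ω ≠ 0) {z z' : ℕ → ℂ}
    (hz0 : ∀ᶠ k in l, z k ≠ 0) (hz : Tendsto (fun k => (z k)⁻¹) l (𝓝 0))
    (hz0' : ∀ᶠ k in l, z' k ≠ 0) (hz' : Tendsto (fun k => (z' k)⁻¹) l (𝓝 0)) :
    Tendsto (fun k => pairDev (a k) (b k) (z k) (z' k)) l (𝓝 0) := by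
  have ha := h.tendsto_inv_left hω
  have h1 := ((h.3.sub hz').mul (ha.sub hz)).div
    (((h.3.mul hz').sub_const 1).mul ((ha.mul hz).sub_const 1)) (by simp)
  simp only [sub_zero, mul_zero, zero_div] at h1
  refine h1.congr' ?_
  filter_upwards [h.1, hz0, hz0'] with k h2 h3 h4
  have := h2.1
  have := h2.2
  simp only [Pi.div_apply, pairDev]
  have e1 : (b k)⁻¹ - (z' k)⁻¹ = (z' k - b k) * ((b k)⁻¹ * (z' k)⁻¹) := by field_simp
  have e2 : (a k)⁻¹ - (z k)⁻¹ = (z k - a k) * ((a k)⁻¹ * (z k)⁻¹) := by field_simp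
  have e3 : (b k)⁻¹ * (z' k)⁻¹ - 1 = (1 - b k * z' k) * ((b k)⁻¹ * (z' k)⁻¹) := by field_simp
  have e4 : (a k)⁻¹ * (z k)⁻¹ - 1 = (1 - a k * z k) * ((a k)⁻¹ * (z k)⁻¹) := by field_simp
  have h5 : (b k)⁻¹ * (z' k)⁻¹ * ((a k)⁻¹ * (z k)⁻¹) ≠ 0 := by simp [*]
  rw [e1, e2, e3, e4, mul_mul_mul_comm, mul_mul_mul_comm (1 - b k * z' k),
    mul_div_mul_right _ _ h5]

/-- Orbits of period dividing `n` all of whose points tend to infinity. -/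
structure IsEscaping (l : Filter ℕ) (a b : ℕ → ℂ) (n : ℕ) (z : ℕ → ℕ → ℂ) : Prop where
  isOrbit : ∀ᶠ k in l, IsOrbit (a k) (b k) n (z k)
  tendsto_inv : ∀ i, Tendsto (fun k => (z k i)⁻¹) l (𝓝 0)

theorem IsEscaping.shift (h : IsEscaping l a b n z) (s : ℕ) :
    IsEscaping l a b n (fun k i => z k (i + s)) :=
  ⟨h.1.mono fun _ hk => hk.shift s, fun i => h.2 (i + s)⟩

theorem IsEscaping.symm (h : IsEscaping l a b n z) : IsEscaping l b a n z :=
  ⟨h.1.mono fun _ hk => hk.symm, h.2⟩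

theorem IsEscaping.mono {l' : Filter ℕ} (h : IsEscaping l a b n z) (hl : l' ≤ l) :
    IsEscaping l' a b n z := ⟨hl h.1, fun i => (h.2 i).mono_left hl⟩

theorem IsEscaping.tendsto_dev (h : IsEscaping l a b n z) (hp : IsLimitParam l a b ω) (hω : ω ≠ 0)
    (i : ℕ) : Tendsto (fun k => dev (a k) (b k) (z k i)) l (𝓝 0) :=
  hp.tendsto_dev hω (h.1.mono fun _ hk => hk.ne_zero i) (h.2 i)

theorem IsEscaping.tendsto_pairDev {m : ℕ} (h : IsEscaping l a b n z) (h' : IsEscaping l a b m z')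
    (hp : IsLimitParam l a b ω) (hω : ω ≠ 0) (i : ℕ) :
    Tendsto (fun k => pairDev (a k) (b k) (z k i) (z' k i)) l (𝓝 0) :=
  hp.tendsto_pairDev hω (h.1.mono fun _ hk => hk.ne_zero i) (h.2 i)
    (h'.1.mono fun _ hk => hk.ne_zero i) (h'.2 i)

theorem IsEscaping.tendsto_ratio_shift (h : IsEscaping l a b n z) (hp : IsLimitParam l a b ω)
    (hω : ω ≠ 0) (i m : ℕ) :
    Tendsto (fun k => ratio (a k) (b k) (z k i) (z k (i + m))) l (𝓝 (ω ^ m)) := by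
  have h1 := (hp.2.pow m).mul (tendsto_prod_one_add (n := m)
    fun j _ => h.tendsto_dev hp hω (i + j))
  rw [mul_one] at h1
  refine h1.congr' ?_
  filter_upwards [hp.1, h.1] with k h2 h3
  rw [ratio, h3.coord_add h2, mul_div_cancel_right₀ _ (h3.coord_ne_zero i)]

theorem IsEscaping.dvd_period [l.NeBot] (h : IsEscaping l a b n z) (hp : IsLimitParam l a b ω)
    (hω : IsPrimitiveRoot ω q) (hω0 : ω ≠ 0) : q ∣ n := by
  apply hω.dvd_of_pow_eq_one
  refine tendsto_nhds_unique (h.tendsto_ratio_shift hp hω0 0 n) (tendsto_const_nhds.congr' ?_)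
  filter_upwards [h.1] with k h1
  rw [h1.periodic, ratio, div_self (h1.coord_ne_zero 0)]

/-- Escaping orbits have period `q`. -/
theorem IsEscaping.eventually_periodic [l.NeBot] (h : IsEscaping l a b n z)
    (hp : IsLimitParam l a b ω) (hω : IsPrimitiveRoot ω q) (hω0 : ω ≠ 0) (hn : 0 < n) :
    ∀ᶠ k in l, z k q = z k 0 := by
  obtain ⟨m, rfl⟩ := h.dvd_period hp hω hω0
  have hm : m ≠ 0 := by rintro rfl; simp at hn
  have hr : ∀ i, Tendsto (fun k => ratio (a k) (b k) (z k i) (z k (i + q))) l (𝓝 1) := fun i => by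
    rw [← hω.pow_eq_one]
    exact h.tendsto_ratio_shift hp hω0 i q
  have hρ : ∀ i, Tendsto (fun k => ∏ j ∈ range i, (1 + -(ratio (a k) (b k) (z k j) (z k (j + q))
      * pairDev (a k) (b k) (z k j) (z k (j + q))))) l (𝓝 1) := fun i => by
    refine tendsto_prod_one_add fun j _ => ?_
    have := ((hr j).mul (h.tendsto_pairDev (h.shift q) hp hω0 j)).neg
    simpa using this
  have hs : ∀ i, Tendsto (fun k => ratio (a k) (b k) (z k 0) (z k (q * i))) l (𝓝 1) := fun i => by
    have := h.tendsto_ratio_shift hp hω0 0 (q * i)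
    rwa [pow_mul, hω.pow_eq_one, one_pow, zero_add] at this
  have hsum := tendsto_finsetSum (range m) fun i _ => (hs i).mul (hρ (q * i))
  have hne : (∑ i ∈ range m, (1 * 1 : ℂ)) ≠ 0 := by simpa using hm
  filter_upwards [hsum.eventually_ne hne, hp.1, h.1] with k h1 h2 h3
  have hw := h3.coord_ne_zero
  -- The increments of the coordinate over blocks of `q` steps telescope to zero around the cycle.
  -- Each is the first increment times a factor tending to `1`, so their sum is about `m` times the
  -- first, which must vanish.
  have htel : (0 : ℂ) = coord (a k) (b k) (z k 0) *
      ((ratio (a k) (b k) (z k 0) (z k (0 + q)) - 1) *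
      ∑ i ∈ range m, ratio (a k) (b k) (z k 0) (z k (q * i)) *
        ∏ j ∈ range (q * i), (1 + -(ratio (a k) (b k) (z k j) (z k (j + q))
          * pairDev (a k) (b k) (z k j) (z k (j + q))))) := by
    have h4 := sum_range_sub (fun i => coord (a k) (b k) (z k (q * i))) m
    have h5 := h3.periodic 0
    rw [zero_add] at h5
    rw [h5, mul_zero, sub_self] at h4
    rw [← h4, mul_sum, mul_sum]
    refine sum_congr rfl fun i _ => ?_
    have h6 := ratio_eq_prod h2 h3 (h3.shift q) (q * i)
    rw [mul_left_comm (_ - 1), ← h6, ratio, ratio, mul_add, mul_one]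
    have := hw 0
    have := hw (q * i)
    field_simp
  rcases mul_eq_zero.1 htel.symm with h4 | h4
  · exact absurd h4 (hw 0)
  · have h5 := sub_eq_zero.1 ((mul_eq_zero.1 h4).resolve_right h1)
    rw [zero_add, ratio, div_eq_one_iff_eq (hw 0)] at h5
    exact coord_injective h2.3 (h3.ne_right _) (h3.ne_right _) h5

end Limits

/-! ### Cycles with a finite nonzero limit point. -/

section FiniteLimit

variable {l : Filter ℕ} {a b : ℕ → ℂ} {ω : ℂ} {q : ℕ} {z z' : ℕ → ℕ → ℂ}

/-- Points whose coordinate tends to a limit `x ≠ ω` escape to infinity. -/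
theorem IsLimitParam.tendsto_inv_of_coord (hp : IsLimitParam l a b ω) {z : ℕ → ℂ} {x : ℂ}
    (hz0 : ∀ᶠ k in l, z k ≠ 0) (hzb : ∀ᶠ k in l, z k ≠ b k)
    (hw : Tendsto (fun k => coord (a k) (b k) (z k)) l (𝓝 x)) (hx : x ≠ ω) :
    Tendsto (fun k => b k * (z k)⁻¹) l (𝓝 ((1 - x) / (ω - x))) ∧
      Tendsto (fun k => (z k)⁻¹) l (𝓝 0) := by
  have h1 : Tendsto (fun k => b k * (z k)⁻¹) l (𝓝 ((1 - x) / (ω - x))) := by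
    refine ((hw.const_sub 1).div (hp.2.sub hw) (sub_ne_zero.2 hx.symm)).congr' ?_
    filter_upwards [hp.1, hz0, hzb] with k h2 h3 h4
    have h5 : 1 - coord (a k) (b k) (z k) = (a k - b k) / (z k - b k) := by
      have := sub_ne_zero.2 h4
      rw [coord]; field_simp; ring
    have h6 : a k / b k - coord (a k) (b k) (z k) = (a k - b k) / (z k - b k) * (z k / b k) := by
      have := sub_ne_zero.2 h4
      have := h2.2
      rw [coord]; field_simp; ring
    have h7 : (a k - b k) / (z k - b k) ≠ 0 :=
      div_ne_zero (sub_ne_zero.2 h2.3) (sub_ne_zero.2 h4)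
    simp only [Pi.div_apply]
    rw [h5, h6, div_mul_cancel_left₀ h7, inv_div, div_eq_mul_inv]
  refine ⟨h1, ?_⟩
  have h2 := hp.3.mul h1
  rw [zero_mul] at h2
  refine h2.congr' ?_
  filter_upwards [hp.1] with k hk
  rw [inv_mul_cancel_left₀ hk.2]

theorem IsLimitParam.tendsto_coord_of_tendsto (hp : IsLimitParam l a b ω) {z : ℕ → ℂ} {p : ℂ}
    (hz : Tendsto z l (𝓝 p)) : Tendsto (fun k => coord (a k) (b k) (z k)) l (𝓝 ω) := by
  have h1 := hz.mul hp.3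
  rw [mul_zero] at h1
  have h2 := (h1.sub hp.2).div (h1.sub_const 1) (by simp)
  have h3 : (0 - ω) / (0 - 1) = ω := by ring
  rw [h3] at h2
  refine h2.congr' ?_
  filter_upwards [hp.1] with k hk
  have := hk.2
  simp only [Pi.div_apply, coord]
  rw [← mul_div_mul_right (z k - a k) _ (inv_ne_zero hk.2)]
  congr 1 <;> field_simp

/-- If there is an escaping orbit of period `q`, no orbit of period `q` has a point with a limit in
`ℂ ∖ {0}`. -/
theorem IsEscaping.not_tendsto [l.NeBot] (h : IsEscaping l a b q z) (hp : IsLimitParam l a b ω)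
    (hq : 0 < q) (hω : IsPrimitiveRoot ω q)
    (h' : ∀ᶠ k in l, IsOrbit (a k) (b k) q (z' k)) {p : ℂ} (hp0 : p ≠ 0)
    (hlim : Tendsto (fun k => z' k 0) l (𝓝 p)) : False := by
  have hω0 : ω ≠ 0 := hω.ne_zero hq.ne'
  have hz0 : ∀ i, ∀ᶠ k in l, z k i ≠ 0 := fun i => h.1.mono fun _ hk => hk.ne_zero i
  have hz0' : ∀ i, ∀ᶠ k in l, z' k i ≠ 0 := fun i => h'.mono fun _ hk => hk.ne_zero i
  have h1 := tendsto_sub_one_div_of_mul_prod_eq_one (n := q) (fun i _ => h.tendsto_dev hp hω0 i)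
    (fun i _ => hp.tendsto_dev_div (hz0 i) (h.2 i))
    (Λ := fun k => (a k / b k) ^ q) (by
      filter_upwards [hp.1, h.1] with k h2 h3 using h3.prod_eq_one h2)
  -- After leaving `p`, whose coordinate tends to `ω`, the orbit does not meet `ω` again within `q`
  -- steps, so its other points escape.
  have hne : ∀ j, 0 < j → j < q → ω ^ (j + 1) ≠ ω := fun j h0 hj h2 => by
    rw [pow_succ] at h2
    exact hω.pow_ne_one_of_pos_of_lt h0.ne' hj (mul_eq_right₀ hω0 |>.1 h2)
  have hinv : ∀ j < q, Tendsto (fun k => coord (a k) (b k) (z' k j)) l (𝓝 (ω ^ (j + 1))) →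
      Tendsto (fun k => (z' k j)⁻¹) l (𝓝 (if j = 0 then p⁻¹ else 0)) := by
    intro j hj hw
    split_ifs with h0
    · subst h0
      exact hlim.inv₀ hp0
    · exact (hp.tendsto_inv_of_coord (hz0' j) (h'.mono fun _ hk => hk.ne_right j) hw
        (hne j (Nat.pos_of_ne_zero h0) hj)).2
  have hw : ∀ j < q, Tendsto (fun k => coord (a k) (b k) (z' k j)) l (𝓝 (ω ^ (j + 1))) := by
    intro j
    induction j with
    | zero => intro _; simpa using hp.tendsto_coord_of_tendsto hlim
    | succ j ih =>
      intro hj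
      have h2 := ih (by omega)
      have h3 := hp.tendsto_dev hω0 (hz0' j) (hinv j (by omega) h2)
      have h4 := (hp.2.mul (h3.const_add 1)).mul h2
      rw [add_zero, mul_one, ← pow_succ'] at h4
      refine h4.congr' ?_
      filter_upwards [hp.1, h'] with k h5 h6
      rw [h6.coord_succ' h5]
  have h2 := tendsto_sub_one_div_of_mul_prod_eq_one (n := q)
    (fun i hi => hp.tendsto_dev hω0 (hz0' i) (hinv i hi (hw i hi)))
    (fun i hi => hp.tendsto_dev_div (hz0' i) (hinv i hi (hw i hi)))
    (Λ := fun k => (a k / b k) ^ q) (by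
      filter_upwards [hp.1, h'] with k h2 h3 using h3.prod_eq_one h2)
  -- The same quotient tends to `0` for the escaping cycle and to `-p⁻¹` for the other.
  have h3 := tendsto_nhds_unique h1 h2
  rw [sum_ite_eq' (range q) 0 fun _ => p⁻¹, if_pos (mem_range.2 hq)] at h3
  simp [hp0] at h3

end FiniteLimit

/-! ### First-order balance on the scale `b⁻²`. -/

section Balance

variable {l : Filter ℕ} {a b : ℕ → ℂ} {ω x : ℂ} {q n : ℕ} {z z' : ℕ → ℕ → ℂ}

theorem IsEscaping.tendsto_coord (h : IsEscaping l a b n z) (hp : IsLimitParam l a b ω)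
    (hω0 : ω ≠ 0) (hw : Tendsto (fun k => coord (a k) (b k) (z k 0)) l (𝓝 x)) (i : ℕ) :
    Tendsto (fun k => coord (a k) (b k) (z k i)) l (𝓝 (ω ^ i * x)) := by
  refine ((h.tendsto_ratio_shift hp hω0 0 i).mul hw).congr' ?_
  filter_upwards [h.1] with k hk
  rw [ratio, div_mul_cancel₀ _ (hk.coord_ne_zero 0), zero_add]

theorem IsEscaping.tendsto_of_ne (h : IsEscaping l a b q z) (hp : IsLimitParam l a b ω)
    (hq : 0 < q) (hω : IsPrimitiveRoot ω q) (hω1 : ω ≠ 1)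
    (hw : Tendsto (fun k => coord (a k) (b k) (z k 0)) l (𝓝 x)) (hx : x ^ q ≠ 1) :
    Tendsto (fun k => ((a k / b k) ^ q - 1) / ((b k ^ 2)⁻¹ * (1 - (a k / b k)⁻¹))) l
      (𝓝 (-rotSum ω q x)) := by
  have hω0 : ω ≠ 0 := hω.ne_zero hq.ne'
  rw [← sum_eq_rotSum hq hω hx]
  refine tendsto_sub_one_div_of_mul_prod_eq_one (fun i _ => h.tendsto_dev hp hω0 i)
    (fun i _ => ?_) (by filter_upwards [hp.1, h.1] with k h2 h3 using h3.prod_eq_one h2)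
  refine (tendsto_rotDev hp.2 hp.tendsto_c (h.tendsto_coord hp hω0 hw i)
    (sub_pow_mul_ne_zero hω hx i)).congr' ?_
  filter_upwards [hp.1, h.1, eventually_eta_ne_zero hω0 hω1 hp.2 hp.c_ne_zero] with k h2 h3 h4
  rw [h3.dev_eq h2, mul_div_cancel_left₀ _ h4]

theorem IsEscaping.tendsto_of_coord_inv (h : IsEscaping l a b q z) (hp : IsLimitParam l a b ω)
    (hω0 : ω ≠ 0) (hω1 : ω ≠ 1)
    (hw : Tendsto (fun k => (coord (a k) (b k) (z k 0))⁻¹) l (𝓝 0)) :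
    Tendsto (fun k => ((a k / b k) ^ q - 1) / ((b k ^ 2)⁻¹ * (1 - (a k / b k)⁻¹))) l
      (𝓝 (-q)) := by
  have hsum : ∑ _i ∈ range q, (1 : ℂ) = q := by simp
  rw [← hsum]
  refine tendsto_sub_one_div_of_mul_prod_eq_one (fun i _ => h.tendsto_dev hp hω0 i)
    (fun i _ => ?_) (by filter_upwards [hp.1, h.1] with k h2 h3 using h3.prod_eq_one h2)
  have hwi : Tendsto (fun k => (coord (a k) (b k) (z k i))⁻¹) l (𝓝 0) := by
    simp only [coord_inv] at hw ⊢
    simpa using h.symm.tendsto_coord (hp.symm hω0) (inv_ne_zero hω0) hw i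
  have h1 := (hwi.sub_const 1).div (((hp.2.mul hwi).sub_const 1).sub
    (hp.tendsto_c.mul (hwi.sub_const 1))) (by simp)
  have h0 : ((0 : ℂ) - 1) / (ω * 0 - 1 - 0 * (0 - 1)) = 1 := by simp
  rw [h0] at h1
  refine h1.congr' ?_
  filter_upwards [hp.1, h.1, eventually_eta_ne_zero hω0 hω1 hp.2 hp.c_ne_zero] with k h2 h3 h4
  rw [h3.dev_eq h2, mul_div_cancel_left₀ _ h4, rotDev]
  have h5 := h3.coord_ne_zero i
  simp only [Pi.div_apply]
  rw [← mul_div_mul_right _ _ h5]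
  congr 1 <;> field_simp

theorem pow_mul_ne_of_lt (hω : IsPrimitiveRoot ω q) (hω0 : ω ≠ 0) {i : ℕ} (h0 : i ≠ 0)
    (hi : i < q) : ω ^ i * ω ≠ ω := fun h =>
  hω.pow_ne_one_of_pos_of_lt h0 hi ((mul_eq_right₀ hω0).1 h)

/-- Orbits passing near the pole of the limit rotation are incompatible with a finite limit. -/
theorem IsEscaping.not_tendsto_of_pole [l.NeBot] (h : IsEscaping l a b q z)
    (hp : IsLimitParam l a b ω) (hq : 0 < q) (hω : IsPrimitiveRoot ω q) (hω1 : ω ≠ 1)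
    (hw : Tendsto (fun k => coord (a k) (b k) (z k 0)) l (𝓝 ω)) {L : ℂ}
    (hL : Tendsto (fun k => ((a k / b k) ^ q - 1) / ((b k ^ 2)⁻¹ * (1 - (a k / b k)⁻¹))) l
      (𝓝 L)) : False := by
  have hω0 : ω ≠ 0 := hω.ne_zero hq.ne'
  have hη := eventually_eta_ne_zero hω0 hω1 hp.2 hp.c_ne_zero
  have hwi := h.tendsto_coord hp hω0 hw
  have hcoord1 : ∀ᶠ k in l, 1 - coord (a k) (b k) (z k 0) ≠ 0 :=
    (hw.const_sub 1).eventually_ne (sub_ne_zero.2 hω1.symm)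
  have hinv : Tendsto (fun k => (rotDev (a k / b k) (b k ^ 2)⁻¹ (coord (a k) (b k) (z k 0)))⁻¹) l
      (𝓝 0) := by
    have h1 := ((hp.2.sub hw).sub (hp.tendsto_c.mul (hw.const_sub 1))).div (hw.const_sub 1)
      (sub_ne_zero.2 hω1.symm)
    simp only [sub_self, zero_mul, zero_div] at h1
    exact h1.congr fun k => (inv_div _ _).symm
  have hne : ∀ᶠ k in l, rotDev (a k / b k) (b k ^ 2)⁻¹ (coord (a k) (b k) (z k 0)) ≠ 0 := by
    filter_upwards [hp.1, h.1, hcoord1] with k h2 h3 h4 h5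
    have h6 := h3.dev_eq h2 0
    rw [h5, mul_zero, dev, div_eq_zero_iff] at h6
    rcases h6 with h6 | h6
    · exact h2.3 (inv_injective (sub_eq_zero.1 h6)).symm
    · exact h3.sub_inv_ne_zero h2 0 h6
  -- Only the point near the pole has unbounded `rotDev`, so its deviation dominates the product; a
  -- finite `L` would make this quotient tend to `0`, not `-1`.
  have hlim : Tendsto (fun k => ((a k / b k) ^ q - 1) / dev (a k) (b k) (z k 0)) l
      (𝓝 (-∑ i ∈ range q, if i = 0 then (1 : ℂ) else 0)) := by
    refine tendsto_sub_one_div_of_mul_prod_eq_one (fun i _ => h.tendsto_dev hp hω0 i)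
      (fun i hi => ?_) (by filter_upwards [hp.1, h.1] with k h2 h3 using h3.prod_eq_one h2)
    split_ifs with h0
    · subst h0
      refine tendsto_const_nhds.congr' ?_
      filter_upwards [hp.1, h.1, hη, hne] with k h2 h3 h4 h5
      rw [h3.dev_eq h2, div_self (mul_ne_zero h4 h5)]
    · have h1 := (tendsto_rotDev hp.2 hp.tendsto_c (hwi i)
        (sub_ne_zero.2 (pow_mul_ne_of_lt hω hω0 h0 hi).symm)).mul hinv
      rw [mul_zero] at h1
      refine h1.congr' ?_
      filter_upwards [hp.1, h.1, hη, hne] with k h2 h3 h4 h5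
      rw [h3.dev_eq h2, h3.dev_eq h2, mul_div_mul_left _ _ h4]
      exact (div_eq_mul_inv _ _).symm
  rw [sum_ite_eq' (range q) 0 fun _ => (1 : ℂ), if_pos (mem_range.2 hq)] at hlim
  have h1 := hL.mul hinv
  rw [mul_zero] at h1
  have h2 : (0 : ℂ) = -1 := by
    refine tendsto_nhds_unique (h1.congr' ?_) hlim
    filter_upwards [hp.1, h.1, hη, hne] with k h2 h3 h4 h5
    rw [h3.dev_eq h2, ← div_div _ (_ * _)]
    exact (div_eq_mul_inv _ _).symm
  norm_num at h2

/-- Two different escaping cycles cannot both pass near the pole of the limit rotation. -/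
theorem IsEscaping.false_of_poles [l.NeBot] (h : IsEscaping l a b q z) (h' : IsEscaping l a b q z')
    (hp : IsLimitParam l a b ω) (hq : 0 < q) (hω : IsPrimitiveRoot ω q) (hω1 : ω ≠ 1)
    (hne : ∀ᶠ k in l, z k 0 ≠ z' k 0)
    (hw : Tendsto (fun k => coord (a k) (b k) (z k 0)) l (𝓝 ω))
    (hw' : Tendsto (fun k => coord (a k) (b k) (z' k 0)) l (𝓝 ω)) : False := by
  have hω0 : ω ≠ 0 := hω.ne_zero hq.ne'
  have hwi := h.tendsto_coord hp hω0 hw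
  have hwi' := h'.tendsto_coord hp hω0 hw'
  have hr : ∀ i, Tendsto (fun k => ratio (a k) (b k) (z k i) (z' k i)) l (𝓝 1) := fun i => by
    have h1 : ω ^ i * ω ≠ 0 := mul_ne_zero (pow_ne_zero _ hω0) hω0
    have h2 := (hwi' i).div (hwi i) h1
    rwa [div_self h1] at h2
  have hφ : ∀ i, Tendsto (fun k => -(ratio (a k) (b k) (z k i) (z' k i)
      * pairDev (a k) (b k) (z k i) (z' k i))) l (𝓝 0) := fun i => by
    simpa using ((hr i).mul (h.tendsto_pairDev h' hp hω0 i)).neg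
  -- Both orbits close up after `q` steps and differ, so the nonzero factor `ratio - 1` cancels.
  have hprod : ∀ᶠ k in l, ∏ i ∈ range q, (1 + -(ratio (a k) (b k) (z k i) (z' k i)
      * pairDev (a k) (b k) (z k i) (z' k i))) = 1 := by
    filter_upwards [hp.1, h.1, h'.1, hne] with k h1 h2 h3 h4
    have h5 := ratio_eq_prod h1 h2 h3 q
    have e1 := h2.periodic 0
    have e2 := h3.periodic 0
    rw [zero_add] at e1 e2
    rw [e1, e2] at h5
    refine (mul_left_cancel₀ ?_ ((mul_one _).trans h5)).symm
    rw [ratio, sub_ne_zero]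
    intro h6
    rw [div_eq_one_iff_eq (h2.coord_ne_zero 0)] at h6
    exact h4 (coord_injective h1.3 (h2.ne_right 0) (h3.ne_right 0) h6.symm)
  have hsmall : ∀ {z : ℕ → ℕ → ℂ}, IsEscaping l a b q z →
      Tendsto (fun k => coord (a k) (b k) (z k 0)) l (𝓝 ω) →
      Tendsto (fun k => z k 0 * (b k)⁻¹) l (𝓝 0) := by
    intro z h hw
    have h1 := (hp.2.sub hw).div (hw.const_sub 1) (sub_ne_zero.2 hω1.symm)
    rw [sub_self, zero_div] at h1
    refine h1.congr' ?_
    filter_upwards [hp.1, h.1] with k h2 h3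
    have h4 := sub_ne_zero.2 (h3.ne_right 0)
    have h5 := sub_ne_zero.2 h2.3
    have h6 := h2.2
    have h7 : 1 - coord (a k) (b k) (z k 0) = (a k - b k) / (z k 0 - b k) := by
      rw [coord]; field_simp; ring
    have h8 : a k / b k - coord (a k) (b k) (z k 0)
        = (z k 0 * (b k)⁻¹) * ((a k - b k) / (z k 0 - b k)) := by
      rw [coord]; field_simp; ring
    simp only [Pi.div_apply]
    rw [h7, h8, mul_div_cancel_right₀ _ (div_ne_zero h5 h4)]
  have hs := hsmall h hw
  have hs' := hsmall h' hw'
  -- Near the pole `z / b → 0`, so `pairDev` at index `0` is much larger than `b⁻²`, while at the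
  -- other indices it is of order at most `b⁻²`. A single term thus dominates the product.
  have hε0 : Tendsto (fun k => (b k ^ 2)⁻¹ / pairDev (a k) (b k) (z k 0) (z' k 0)) l (𝓝 0) := by
    have h1 := ((hp.tendsto_c.sub hs').mul (hp.tendsto_c.sub (hp.2.mul hs))).div
      ((hs'.sub_const 1).mul (hs.sub hp.2)) (by simpa using hω0)
    simp only [mul_zero, sub_zero, zero_div] at h1
    refine h1.congr' ?_
    filter_upwards [hp.1, h.1, h'.1] with k h2 h3 h4
    have h5 := h2.2
    simp only [Pi.div_apply, pairDev]
    have e1 : (b k ^ 2)⁻¹ - z' k 0 * (b k)⁻¹ = (1 - b k * z' k 0) * (b k ^ 2)⁻¹ := by field_simp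
    have e2 : (b k ^ 2)⁻¹ - a k / b k * (z k 0 * (b k)⁻¹) = (1 - a k * z k 0) * (b k ^ 2)⁻¹ := by
      field_simp
    have e3 : z' k 0 * (b k)⁻¹ - 1 = (z' k 0 - b k) * (b k)⁻¹ := by field_simp
    have e4 : z k 0 * (b k)⁻¹ - a k / b k = (z k 0 - a k) * (b k)⁻¹ := by field_simp
    have h6 := sub_ne_zero.2 (h3.ne_left 0)
    have h7 := sub_ne_zero.2 (h4.ne_right 0)
    rw [e1, e2, e3, e4, div_div_eq_mul_div]
    field_simp
  have hεi : ∀ i, i ≠ 0 → i < q → ∃ p, Tendsto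
      (fun k => pairDev (a k) (b k) (z k i) (z' k i) / (b k ^ 2)⁻¹) l (𝓝 p) := by
    intro i hi0 hi
    have hx := pow_mul_ne_of_lt hω hω0 hi0 hi
    have h1 := (hp.tendsto_inv_of_coord (h.1.mono fun _ hk => hk.ne_zero i)
      (h.1.mono fun _ hk => hk.ne_right i) (hwi i) hx).1
    have h1' := (hp.tendsto_inv_of_coord (h'.1.mono fun _ hk => hk.ne_zero i)
      (h'.1.mono fun _ hk => hk.ne_right i) (hwi' i) hx).1
    have h2 := ((h1'.const_sub 1).mul ((hp.2.mul h1).const_sub 1)).div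
      ((((h'.2 i).mul hp.3).sub_const 1).mul (((h.2 i).mul hp.3).sub hp.2)) (by simpa using hω0)
    refine ⟨_, h2.congr' ?_⟩
    filter_upwards [hp.1, h.1, h'.1] with k h3 h4 h5
    have h6 := h3.2
    have h7 := h4.ne_zero i
    have h8 := h5.ne_zero i
    simp only [Pi.div_apply, pairDev]
    have e1 : 1 - b k * (z' k i)⁻¹ = (z' k i - b k) * (z' k i)⁻¹ := by field_simp
    have e2 : 1 - a k / b k * (b k * (z k i)⁻¹) = (z k i - a k) * (z k i)⁻¹ := by field_simp
    have e3 : (z' k i)⁻¹ * (b k)⁻¹ - 1 = (1 - b k * z' k i) * ((z' k i)⁻¹ * (b k)⁻¹) := by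
      field_simp
    have e4 : (z k i)⁻¹ * (b k)⁻¹ - a k / b k = (1 - a k * z k i) * ((z k i)⁻¹ * (b k)⁻¹) := by
      field_simp
    have h9 := h5.one_sub_mul_ne_zero h3 i
    have h10 := h4.symm.one_sub_mul_ne_zero h3.symm i
    rw [e1, e2, e3, e4]
    generalize 1 - b k * z' k i = D at *
    generalize 1 - a k * z k i = E at *
    field_simp
  -- The limit is set to `0` at irrelevant indices so that it can be chosen for all `i`.
  have hε : ∀ i, ∃ p, i ≠ 0 → i < q → Tendsto
      (fun k => pairDev (a k) (b k) (z k i) (z' k i) / (b k ^ 2)⁻¹) l (𝓝 p) := fun i => by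
    by_cases hi : i ≠ 0 ∧ i < q
    · obtain ⟨p, h1⟩ := hεi i hi.1 hi.2
      exact ⟨p, fun _ _ => h1⟩
    · exact ⟨0, fun h1 h2 => absurd ⟨h1, h2⟩ hi⟩
  choose p hε using hε
  have hpair0 : ∀ᶠ k in l, pairDev (a k) (b k) (z k 0) (z' k 0) ≠ 0 := by
    filter_upwards [hp.1, h.1, h'.1] with k h1 h2 h3
    exact div_ne_zero (mul_ne_zero (sub_ne_zero.2 (h3.ne_right 0)) (sub_ne_zero.2 (h2.ne_left 0)))
      (mul_ne_zero (h3.one_sub_mul_ne_zero h1 0) (h2.symm.one_sub_mul_ne_zero h1.symm 0))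
  have hsum := tendsto_prod_one_add_sub_one_div (n := q) (fun i _ => hφ i)
    (η := fun k => pairDev (a k) (b k) (z k 0) (z' k 0))
    (p := fun i => if i = 0 then (-1 : ℂ) else 0) (fun i hi => by
      split_ifs with h0
      · subst h0
        refine (hr 0).neg.congr' ?_
        filter_upwards [hpair0] with k hk
        rw [neg_div, mul_div_cancel_right₀ _ hk]
      · have h1 := ((hr i).mul ((hε i h0 hi).mul hε0)).neg
        simp only [mul_zero, neg_zero] at h1
        refine h1.congr' ?_
        filter_upwards [hp.c_ne_zero] with k hk
        rw [neg_div, div_mul_div_cancel₀ hk, mul_div_assoc])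
  rw [sum_ite_eq' (range q) 0 fun _ => (-1 : ℂ), if_pos (mem_range.2 hq)] at hsum
  have h2 : (0 : ℂ) = -1 := by
    refine tendsto_nhds_unique (tendsto_const_nhds.congr' ?_) hsum
    filter_upwards [hprod] with k hk
    rw [hk, sub_self, zero_div]
  norm_num at h2

end Balance

/-! ### At most one escaping cycle. -/

section Uniqueness

variable {U : Ultrafilter ℕ} {a b : ℕ → ℂ} {ω x : ℂ} {q n : ℕ} {z z' : ℕ → ℕ → ℂ}

theorem exists_pow_mul_eq (hq : 0 < q) (hω : IsPrimitiveRoot ω q) {x y : ℂ} (hx : x ≠ 0)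
    (h : x ^ q = y ^ q) : ∃ s, ω ^ s * x = y := by
  have : NeZero q := ⟨hq.ne'⟩
  obtain ⟨s, -, hs⟩ := hω.eq_pow_of_pow_eq_one (ξ := y / x) (by
    rw [div_pow, ← h, div_self (pow_ne_zero _ hx)])
  exact ⟨s, by rw [hs, div_mul_cancel₀ _ hx]⟩

/-- Along an ultrafilter, a sequence in `ℂ` converges to a point or to infinity. -/
theorem exists_tendsto_or_tendsto_inv (w : ℕ → ℂ) :
    (∃ x, Tendsto w U (𝓝 x)) ∨ Tendsto (fun k => (w k)⁻¹) U (𝓝 0) := by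
  by_cases h : ∃ R : ℝ, ∀ᶠ k in (U : Filter ℕ), w k ∈ Metric.closedBall 0 R
  · obtain ⟨R, hR⟩ := h
    obtain ⟨x, -, hx⟩ := (isCompact_closedBall (0 : ℂ) R).ultrafilter_le_nhds (U.map w)
      (le_principal_iff.2 hR)
    exact Or.inl ⟨x, hx⟩
  · push Not at h
    right
    refine tendsto_inv₀_cobounded.comp ?_
    rw [tendsto_norm_atTop_iff_cobounded.symm, tendsto_atTop]
    intro R
    filter_upwards [h R] with k hk
    rw [mem_closedBall_zero_iff, not_le] at hk
    exact hk.le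

theorem IsEscaping.false_of_two_of_tendsto (h : IsEscaping U a b q z) (h' : IsEscaping U a b q z')
    (hp : IsLimitParam U a b ω) (hq : 0 < q) (hω : IsPrimitiveRoot ω q) (hω1 : ω ≠ 1)
    (hne : ∀ᶠ k in (U : Filter ℕ), ∀ i j, z k i ≠ z' k j)
    (hinj : ∀ᶠ k in (U : Filter ℕ), ∀ i < q, ∀ j < q, z k i = z k j → i = j)
    (hw : Tendsto (fun k => coord (a k) (b k) (z k 0)) U (𝓝 x)) : False := by
  have hω0 : ω ≠ 0 := hω.ne_zero hq.ne'
  have hq0 : (q : ℂ) ≠ 0 := Nat.cast_ne_zero.2 hq.ne'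
  have hK : (ω⁻¹ - 1) * (q : ℂ) ≠ 0 := mul_ne_zero (sub_ne_zero.2 (inv_ne_one.2 hω1)) hq0
  have hpole : ∀ {z : ℕ → ℕ → ℂ} {x : ℂ}, IsEscaping U a b q z → x ^ q = 1 →
      Tendsto (fun k => coord (a k) (b k) (z k 0)) U (𝓝 x) →
      ∃ s, Tendsto (fun k => coord (a k) (b k) (z k (0 + s))) U (𝓝 ω) := by
    intro z x h hx hw
    have hx0 : x ≠ 0 := by rintro rfl; simp [hq.ne'] at hx
    obtain ⟨s, hs⟩ := exists_pow_mul_eq hq hω hx0 (hx.trans hω.pow_eq_one.symm)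
    refine ⟨s, ?_⟩
    rw [← hs, zero_add]
    exact h.tendsto_coord hp hω0 hw s
  by_cases hx : x ^ q = 1
  · obtain ⟨s, hs⟩ := hpole h hx hw
    rcases exists_tendsto_or_tendsto_inv (U := U) (fun k => coord (a k) (b k) (z' k 0)) with
      ⟨y, hy⟩ | hy
    · by_cases hy1 : y ^ q = 1
      · obtain ⟨s', hs'⟩ := hpole h' hy1 hy
        exact (h.shift s).false_of_poles (h'.shift s') hp hq hω hω1
          (hne.mono fun k hk => hk _ _) hs hs'
      · exact (h.shift s).not_tendsto_of_pole hp hq hω hω1 hs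
          (h'.tendsto_of_ne hp hq hω hω1 hy hy1)
    · exact (h.shift s).not_tendsto_of_pole hp hq hω hω1 hs
        (h'.tendsto_of_coord_inv hp hω0 hω1 hy)
  have hL := h.tendsto_of_ne hp hq hω hω1 hw hx
  have hx1 : 1 - x ^ q ≠ 0 := sub_ne_zero.2 (Ne.symm hx)
  rcases exists_tendsto_or_tendsto_inv (U := U) (fun k => coord (a k) (b k) (z' k 0)) with
    ⟨y, hy⟩ | hy
  · by_cases hy1 : y ^ q = 1
    · obtain ⟨s, hs⟩ := hpole h' hy1 hy
      exact (h'.shift s).not_tendsto_of_pole hp hq hω hω1 hs hL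
    have hxy : x ^ q = y ^ q := by
      have h1 := tendsto_nhds_unique hL (h'.tendsto_of_ne hp hq hω hω1 hy hy1)
      have hy2 : 1 - y ^ q ≠ 0 := sub_ne_zero.2 (Ne.symm hy1)
      rw [neg_inj, rotSum, rotSum, add_right_inj, ← mul_div_assoc, ← mul_div_assoc,
        div_eq_div_iff hx1 hy2] at h1
      have h2 := mul_left_cancel₀ hK h1
      linear_combination h2
    by_cases hx0 : x = 0
    · subst hx0
      have hy0 : y = 0 := by
        rw [zero_pow hq.ne'] at hxy
        exact pow_eq_zero_iff hq.ne' |>.1 hxy.symm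
      subst hy0
      -- At the fixed point `0` of the rotation the limit function has order `q`; one full cycle and
      -- one point of the other give `q + 1` zeros.
      refine false_of_zeros (N := q + 1) (s := fun k => insert (coord (a k) (b k) (z' k 0))
        ((range q).image fun i => coord (a k) (b k) (z k i))) hq hω hω1 hp.2 hp.tendsto_c
        hp.c_ne_zero hx hL ?_ ?_ ?_ (by omega) (fun _ => by omega)
      · intro ε hε
        have h1 : ∀ᶠ k in (U : Filter ℕ), ∀ i ∈ Set.Iio q,
            coord (a k) (b k) (z k i) ∈ Metric.ball 0 ε := by
          refine (eventually_all_finite (Set.finite_Iio q)).2 fun i _ => ?_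
          have h2 := h.tendsto_coord hp hω0 hw i
          rw [mul_zero] at h2
          exact h2.eventually (Metric.ball_mem_nhds _ hε)
        filter_upwards [h1, hy.eventually (Metric.ball_mem_nhds _ hε)] with k h2 h3 j hj
        simp only [Finset.mem_insert, Finset.mem_image, Finset.mem_range] at hj
        rcases hj with rfl | ⟨i, hi, rfl⟩
        · exact h3
        · exact h2 i hi
      · filter_upwards [hp.1, h.1, h'.1] with k h1 h2 h3 j hj
        simp only [Finset.mem_insert, Finset.mem_image, Finset.mem_range] at hj
        rcases hj with rfl | ⟨i, hi, rfl⟩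
        · exact h3.rotQuot_eq_zero h1 0
        · exact h2.rotQuot_eq_zero h1 i
      · filter_upwards [hp.1, h.1, h'.1, hne, hinj] with k h1 h2 h3 h4 h5
        rw [card_insert_of_notMem, card_image_of_injOn, card_range]
        · intro i hi j hj hij
          exact h5 i (by simpa using hi) j (by simpa using hj)
            (coord_injective h1.3 (h2.ne_right _) (h2.ne_right _) hij)
        · simp only [Finset.mem_image, not_exists, not_and]
          intro i _ hi
          exact h4 i 0 (coord_injective h1.3 (h2.ne_right _) (h3.ne_right _) hi)
    · have hy0 : y ≠ 0 := by
        rintro rfl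
        rw [zero_pow hq.ne'] at hxy
        exact hx0 (pow_eq_zero_iff hq.ne' |>.1 hxy)
      obtain ⟨s, hs⟩ := exists_pow_mul_eq hq hω hy0 hxy.symm
      have hys := h'.tendsto_coord hp hω0 hy s
      rw [hs] at hys
      -- After a shift both cycles have a point tending to `x ≠ 0`, where the limit function has a
      -- simple zero.
      refine false_of_zeros (N := 2) (s := fun k => {coord (a k) (b k) (z k 0),
        coord (a k) (b k) (z' k s)}) hq hω hω1 hp.2 hp.tendsto_c
        hp.c_ne_zero hx hL ?_ ?_ ?_ le_rfl (fun h0 => absurd h0 hx0)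
      · intro ε hε
        filter_upwards [hw.eventually (Metric.ball_mem_nhds _ hε),
          hys.eventually (Metric.ball_mem_nhds _ hε)] with k h2 h3 j hj
        simp only [Finset.mem_insert, Finset.mem_singleton] at hj
        rcases hj with rfl | rfl
        · exact h2
        · exact h3
      · filter_upwards [hp.1, h.1, h'.1] with k h1 h2 h3 j hj
        simp only [Finset.mem_insert, Finset.mem_singleton] at hj
        rcases hj with rfl | rfl
        · exact h2.rotQuot_eq_zero h1 0
        · exact h3.rotQuot_eq_zero h1 s
      · filter_upwards [hp.1, h.1, h'.1, hne] with k h1 h2 h3 h4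
        exact card_pair fun hi =>
          h4 0 s (coord_injective h1.3 (h2.ne_right _) (h3.ne_right _) hi)
  · have h1 := tendsto_nhds_unique hL (h'.tendsto_of_coord_inv hp hω0 hω1 hy)
    rw [neg_inj, rotSum, add_eq_left, ← mul_div_assoc, div_eq_zero_iff] at h1
    exact h1.elim hK hx1

/-- Two different cycles of period `q` cannot both escape. -/
theorem IsEscaping.false_of_two (h : IsEscaping U a b q z) (h' : IsEscaping U a b q z')
    (hp : IsLimitParam U a b ω) (hq : 0 < q) (hω : IsPrimitiveRoot ω q) (hω1 : ω ≠ 1)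
    (hne : ∀ᶠ k in (U : Filter ℕ), ∀ i j, z k i ≠ z' k j)
    (hinj : ∀ᶠ k in (U : Filter ℕ), ∀ i < q, ∀ j < q, z k i = z k j → i = j) : False := by
  rcases exists_tendsto_or_tendsto_inv (U := U) (fun k => coord (a k) (b k) (z k 0)) with
    ⟨x, hx⟩ | hx
  · exact h.false_of_two_of_tendsto h' hp hq hω hω1 hne hinj hx
  · simp only [coord_inv] at hx
    -- Exchanging `a` and `b` inverts the coordinate and `ω`, moving the limit from infinity to `0`.
    exact h.symm.false_of_two_of_tendsto h'.symm (hp.symm (hω.ne_zero hq.ne')) hq hω.inv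
      (inv_ne_one.2 hω1) hne hinj hx

end Uniqueness

/-! ### Parameters and eigenvalues from the fixed points. -/

section FixedPoints

theorem eq_of_quadFix {γ δ a b : ℂ} (h : quadFix γ δ = {a, b, 0}) :
    γ = 1 - a * b ∧ δ = -(a + b) := by
  set P : Polynomial ℂ := Polynomial.X * (Polynomial.X ^ 2 + Polynomial.C δ * Polynomial.X + 1)
    - Polynomial.C γ * Polynomial.X with hP
  have hcubic : P = Polynomial.X ^ 3 + Polynomial.C δ * Polynomial.X ^ 2
      + Polynomial.C (1 - γ) * Polynomial.X := by
    rw [hP, Polynomial.C_sub, Polynomial.C_1]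
    ring
  have hmonic : P.Monic := by rw [hcubic]; monicity!
  have hprod := (IsAlgClosed.splits P).eq_prod_roots_of_monic hmonic
  have hroots : P.roots = {a, b, 0} := h
  rw [hroots] at hprod
  have h1 := congrArg (Polynomial.eval 1) hprod
  have h2 := congrArg (Polynomial.eval (-1)) hprod
  simp [hP] at h1 h2
  constructor
  · linear_combination (h2 - h1) / 2
  · linear_combination (h1 + h2) / 2

theorem quadEigenvalue_left {a b : ℂ} (hab : 1 - a * b ≠ 0) :
    quadEigenvalue (1 - a * b) (-(a + b)) a = (1 - a ^ 2) / (1 - a * b) := by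
  have hD : a ^ 2 + -(a + b) * a + 1 = 1 - a * b := by ring
  have h1 : HasDerivAt (fun z : ℂ => (1 - a * b) * z) (1 - a * b) a := by
    simpa using (hasDerivAt_id a).const_mul (1 - a * b)
  have h2 : HasDerivAt (fun z : ℂ => z ^ 2 + -(a + b) * z + 1) (2 * a + -(a + b)) a := by
    simpa using (((hasDerivAt_pow 2 a).add ((hasDerivAt_id a).const_mul (-(a + b)))).add_const 1)
  have h3 := h1.div h2 (by rw [hD]; exact hab)
  have h4 : quadEigenvalue (1 - a * b) (-(a + b)) a = _ := h3.deriv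
  rw [h4, hD]
  field_simp
  ring

theorem quadEigenvalue_right {a b : ℂ} (hab : 1 - a * b ≠ 0) :
    quadEigenvalue (1 - a * b) (-(a + b)) b = (1 - b ^ 2) / (1 - a * b) := by
  rw [mul_comm a b] at hab ⊢
  rw [add_comm a b]
  exact quadEigenvalue_left hab

variable {a b : ℕ → ℂ} {ω : ℂ}

/-- Dividing by `γ = 1 - a b → ∞` gives `a² / γ → -ω` and `a b / γ → -1`; hence `a / b → ω` and `b²
/ γ → -ω⁻¹`, which also forces `b → ∞`. -/
theorem limitParam_of_tendsto (hω0 : ω ≠ 0) (hω1 : ω ≠ 1) (hab : ∀ k, 1 - a k * b k ≠ 0)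
    (hγ : Tendsto (fun k => 1 - a k * b k) atTop (Bornology.cobounded ℂ))
    (hα : Tendsto (fun k => (1 - a k ^ 2) / (1 - a k * b k)) atTop (𝓝 ω)) :
    IsLimitParam atTop a b ω ∧
      Tendsto (fun k => (1 - b k ^ 2) / (1 - a k * b k)) atTop (𝓝 ω⁻¹) := by
  have hγi : Tendsto (fun k => (1 - a k * b k)⁻¹) atTop (𝓝 0) := tendsto_inv₀_cobounded.comp hγ
  have haa : Tendsto (fun k => a k ^ 2 / (1 - a k * b k)) atTop (𝓝 (-ω)) := by
    have h1 := hγi.sub hα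
    rw [zero_sub] at h1
    refine h1.congr fun k => ?_
    have := hab k
    rw [inv_eq_one_div, ← sub_div]
    congr 1
    ring
  have hmul : Tendsto (fun k => a k * b k / (1 - a k * b k)) atTop (𝓝 (-1)) := by
    have h1 := hγi.sub_const 1
    rw [zero_sub] at h1
    refine h1.congr fun k => ?_
    have h2 := hab k
    rw [eq_div_iff h2, sub_mul, inv_mul_cancel₀ h2]
    ring
  have hne : ∀ᶠ k in atTop, a k ≠ 0 ∧ b k ≠ 0 := by
    filter_upwards [hmul.eventually_ne (neg_ne_zero.2 one_ne_zero)] with k hk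
    constructor <;> intro h0 <;> simp [h0] at hk
  have hratio : Tendsto (fun k => a k / b k) atTop (𝓝 ω) := by
    have h1 := haa.div hmul (neg_ne_zero.2 one_ne_zero)
    rw [neg_div_neg_eq, div_one] at h1
    refine h1.congr' ?_
    filter_upwards [hne] with k hk
    obtain ⟨h2, h3⟩ := hk
    simp only [Pi.div_apply]
    rw [div_div_div_cancel_right₀ (hab k)]
    field_simp
  have hbb : Tendsto (fun k => b k ^ 2 / (1 - a k * b k)) atTop (𝓝 (-ω⁻¹)) := by
    have h1 := (hmul.pow 2).div haa (neg_ne_zero.2 hω0)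
    have h2 : (-1 : ℂ) ^ 2 / -ω = -ω⁻¹ := by rw [div_neg]; simp
    rw [h2] at h1
    refine h1.congr' ?_
    filter_upwards [hne] with k hk
    obtain ⟨h2, h3⟩ := hk
    have h4 := hab k
    simp only [Pi.div_apply]
    obtain ⟨D, hD⟩ : ∃ D, D = 1 - a k * b k := ⟨_, rfl⟩
    rw [← hD] at h4 ⊢
    field_simp
  have hbi : Tendsto (fun k => (b k)⁻¹) atTop (𝓝 0) := by
    have h1 := hγi.div hbb (neg_ne_zero.2 (inv_ne_zero hω0))
    rw [zero_div] at h1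
    have h2 : Tendsto (fun k => ‖(b k)⁻¹‖ ^ 2) atTop (𝓝 0) := by
      have h3 := h1.norm
      rw [norm_zero] at h3
      refine h3.congr fun k => ?_
      simp only [Pi.div_apply]
      rw [← norm_pow, inv_eq_one_div, div_div_div_cancel_right₀ (hab k), one_div, inv_pow]
    rw [tendsto_zero_iff_norm_tendsto_zero]
    have h3 := (Real.continuous_sqrt.tendsto 0).comp h2
    rw [Real.sqrt_zero] at h3
    exact h3.congr fun k => Real.sqrt_sq (norm_nonneg _)
  refine ⟨⟨?_, hratio, hbi⟩, ?_⟩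
  · filter_upwards [hne, hratio.eventually_ne hω1] with k h1 h2
    refine ⟨h1.1, h1.2, fun h => h2 ?_, hab k⟩
    rw [h, div_self h1.2]
  · have h1 := hγi.sub hbb
    rw [zero_sub, neg_neg] at h1
    refine h1.congr fun k => ?_
    rw [inv_eq_one_div, ← sub_div]

end FixedPoints

/-! ### From cycles on the sphere to orbits in the plane. -/

section Cycles

variable {a b : ℂ} {n : ℕ} {x : OnePoint ℂ}

theorem quadMap_coe (γ δ z : ℂ) : quadMap γ δ (z : OnePoint ℂ) = if z ^ 2 + δ * z + 1 = 0 then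
    OnePoint.infty else ((quadFormula γ δ z : ℂ) : OnePoint ℂ) := rfl

theorem quadMap_infty (γ δ : ℂ) : quadMap γ δ OnePoint.infty = ((0 : ℂ) : OnePoint ℂ) := rfl

theorem quadMap_zero (γ δ : ℂ) : quadMap γ δ ((0 : ℂ) : OnePoint ℂ) = ((0 : ℂ) : OnePoint ℂ) := by
  rw [quadMap_coe]
  simp [quadFormula]

theorem quadMap_left (hab : 1 - a * b ≠ 0) :
    quadMap (1 - a * b) (-(a + b)) (a : OnePoint ℂ) = (a : OnePoint ℂ) := by
  have hD : a ^ 2 + -(a + b) * a + 1 = 1 - a * b := by ring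
  rw [quadMap_coe, hD, if_neg hab, quadFormula, hD, mul_div_cancel_left₀ _ hab]

theorem quadMap_right (hab : 1 - a * b ≠ 0) :
    quadMap (1 - a * b) (-(a + b)) (b : OnePoint ℂ) = (b : OnePoint ℂ) := by
  have hD : b ^ 2 + -(a + b) * b + 1 = 1 - a * b := by ring
  rw [quadMap_coe, hD, if_neg hab, quadFormula, hD, mul_div_cancel_left₀ _ hab]

theorem HasPeriod.mem_periodicPts {X : Type*} {g : X → X} {x : X} (h : HasPeriod g n x) :
    x ∈ Function.periodicPts g :=
  Function.minimalPeriod_pos_iff_mem_periodicPts.1 (h.2.symm ▸ h.1)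

theorem cycleSet_eq_of_iterate_eq {X : Type*} {g : X → X} {x y : X} {i j : ℕ}
    (hx : x ∈ Function.periodicPts g) (hy : y ∈ Function.periodicPts g)
    (h : g^[i] x = g^[j] y) : cycleSet g x = cycleSet g y := by
  rw [cycleSet, cycleSet, ← Function.periodicOrbit_apply_iterate_eq hx i, h,
    Function.periodicOrbit_apply_iterate_eq hy j]

/-- The points of a cycle that is not a fixed point form an orbit in `ℂ ∖ {0, a, b}`. -/
theorem exists_isOrbit (hab : 1 - a * b ≠ 0) (hn : 1 < n)
    (h : HasPeriod (quadMap (1 - a * b) (-(a + b))) n x) :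
    ∃ z : ℕ → ℂ, (∀ i, (quadMap (1 - a * b) (-(a + b)))^[i] x = (z i : OnePoint ℂ)) ∧
      IsOrbit a b n z ∧ ∀ i < n, ∀ j < n, z i = z j → i = j := by
  set g := quadMap (1 - a * b) (-(a + b)) with hg
  have hx := HasPeriod.mem_periodicPts h
  have hfix : ∀ i, g (g^[i] x) ≠ g^[i] x := fun i hi => by
    have h1 := Function.minimalPeriod_apply_iterate hx i
    have h2 : Function.minimalPeriod g (g^[i] x) = 1 :=
      Function.minimalPeriod_eq_one_iff_isFixedPt.2 hi
    have := h.2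
    omega
  have hinf : ∀ i, g^[i] x ≠ OnePoint.infty := fun i hi => by
    -- A point at `∞` would be followed by the fixed point `0`.
    apply hfix (i + 1)
    rw [Function.iterate_succ_apply', hi, hg, quadMap_infty, quadMap_zero]
  have hz : ∀ i, ∃ z : ℂ, g^[i] x = (z : OnePoint ℂ) := fun i => by
    obtain ⟨z, hz⟩ := OnePoint.ne_infty_iff_exists.1 (hinf i)
    exact ⟨z, hz.symm⟩
  choose z hz using hz
  refine ⟨z, hz, ⟨fun i h0 => ?_, fun i h0 => ?_, fun i h0 => ?_, fun i => ?_, fun i => ?_⟩, ?_⟩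
  · exact hfix i (by rw [hz, h0, hg, quadMap_zero])
  · exact hfix i (by rw [hz, h0, hg, quadMap_left hab])
  · exact hfix i (by rw [hz, h0, hg, quadMap_right hab])
  · have h1 : g (z i : OnePoint ℂ) = (z (i + 1) : OnePoint ℂ) := by
      rw [← hz, ← hz, Function.iterate_succ_apply']
    rw [hg, quadMap_coe] at h1
    split_ifs at h1 with h2
    · exact absurd h1.symm (OnePoint.coe_ne_infty _)
    · have h3 := OnePoint.coe_injective h1
      rw [← h3, quadFormula]
      have h4 : z i ^ 2 - (a + b) * z i + 1 = z i ^ 2 + -(a + b) * z i + 1 := by ring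
      rw [h4, div_mul_cancel₀ _ h2]
  · apply OnePoint.coe_injective
    rw [← hz, ← hz, ← h.2, Function.iterate_add_minimalPeriod_eq]
  · intro i hi j hj hij
    refine Function.iterate_injOn_Iio_minimalPeriod (f := g) (x := x) ?_ ?_ ?_
    · rw [h.2]; exact hi
    · rw [h.2]; exact hj
    · simp only [hz, hij]

end Cycles

/-! ### Consequences of Vietoris convergence. -/

section Sphere

variable {a b : ℕ → ℂ} {ω : ℂ} {q n : ℕ} {S : ℕ → Set (OnePoint ℂ)} {W : Set (OnePoint ℂ)}
  {z : ℕ → ℕ → ℂ}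

theorem SetsTendTo.eventually_subset {X : Type*} [TopologicalSpace X] {S : ℕ → Set X} {W V : Set X}
    (h : SetsTendTo S W) (hV : IsOpen V) (hW : W ⊆ V) : ∀ᶠ k in atTop, S k ⊆ V := by
  let := TopologicalSpace.vietoris X
  exact h.eventually_mem (hV.powerset_vietoris.mem_nhds hW)

theorem SetsTendTo.eventually_nonempty {X : Type*} [TopologicalSpace X] {S : ℕ → Set X}
    {W V : Set X} (h : SetsTendTo S W) (hV : IsOpen V) (hW : (W ∩ V).Nonempty) :
    ∀ᶠ k in atTop, (S k ∩ V).Nonempty := by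
  let := TopologicalSpace.vietoris X
  exact h.eventually_mem
    ((TopologicalSpace.vietoris.isOpen_inter_nonempty_of_isOpen hV).mem_nhds hW)

theorem SetsTendTo.tendsto_inv (h : SetsTendTo S W) (hW : W ⊆ {OnePoint.infty})
    {z : ℕ → ℂ} (hz : ∀ k, (z k : OnePoint ℂ) ∈ S k) :
    Tendsto (fun k => (z k)⁻¹) atTop (𝓝 0) := by
  have h1 : Tendsto (fun k => (z k : OnePoint ℂ)) atTop (𝓝 OnePoint.infty) := by
    rw [tendsto_nhds]
    intro V hV hmem
    filter_upwards [SetsTendTo.eventually_subset h hV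
      (hW.trans (Set.singleton_subset_iff.2 hmem))] with k hk
    exact hk (hz k)
  have h2 : Tendsto z atTop (comap ((↑) : ℂ → OnePoint ℂ) (𝓝 OnePoint.infty)) :=
    tendsto_comap_iff.2 h1
  rw [OnePoint.comap_coe_nhds_infty, coclosedCompact_eq_cocompact,
    ← Metric.cobounded_eq_cocompact] at h2
  exact tendsto_inv₀_cobounded.comp h2

/-- Points of finite orbits can be chosen to converge to a given finite limit point. -/
theorem SetsTendTo.exists_tendsto (h : SetsTendTo S W) {p : ℂ} (hp : (p : OnePoint ℂ) ∈ W)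
    (hq : 0 < q) (hS : ∀ k, ∀ y ∈ S k, ∃ i < q, y = (z k i : OnePoint ℂ)) :
    ∃ s : ℕ → ℕ, Tendsto (fun k => z k (s k)) atTop (𝓝 p) := by
  -- The index `s k` picks the point nearest to `p` among the first `q`.
  have hmin : ∀ k, ∃ s, ∀ i < q, dist (z k s) p ≤ dist (z k i) p := fun k => by
    obtain ⟨s, -, hs⟩ := (range q).exists_min_image (fun i => dist (z k i) p)
      ⟨0, mem_range.2 hq⟩
    exact ⟨s, fun i hi => hs i (mem_range.2 hi)⟩
  choose s hs using hmin
  refine ⟨s, ?_⟩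
  rw [Metric.tendsto_nhds]
  intro ε hε
  have hV : IsOpen (((↑) : ℂ → OnePoint ℂ) '' Metric.ball p ε) :=
    OnePoint.isOpenEmbedding_coe.isOpenMap _ Metric.isOpen_ball
  filter_upwards [SetsTendTo.eventually_nonempty h hV
    ⟨_, hp, Set.mem_image_of_mem _ (Metric.mem_ball_self hε)⟩] with k hk
  obtain ⟨y, hy, v, hv, rfl⟩ := hk
  obtain ⟨i, hi, hvi⟩ := hS k _ hy
  rw [OnePoint.coe_injective hvi] at hv
  exact (hs k i hi).trans_lt hv

/-- The fixed point `0` is so repelling that no cycle stays close to it. -/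
theorem IsLimitParam.not_forall_norm_lt (hp : IsLimitParam atTop a b ω) (hω0 : ω ≠ 0) (hn : 0 < n) :
    ∀ᶠ k in atTop, ∀ z, IsOrbit (a k) (b k) n z → ¬ ∀ i, ‖z i‖ < 1 := by
  have h1 : Tendsto (fun k => 2 * ‖(b k ^ 2)⁻¹‖ + ‖(a k / b k + 1) * (b k)⁻¹‖) atTop (𝓝 0) := by
    have h2 := ((hp.tendsto_c.norm).const_mul 2).add (((hp.2.add_const 1).mul hp.3).norm)
    simpa using h2
  have h2 : Tendsto (fun k => ‖(b k ^ 2)⁻¹ - a k / b k‖) atTop (𝓝 ‖ω‖) := by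
    simpa using (hp.tendsto_c.sub hp.2).norm
  filter_upwards [h1.eventually_lt h2 (norm_pos_iff.2 hω0), hp.1] with k h3 h4 z hz hlt
  have hb : b k ≠ 0 := h4.2
  have hbpos : 0 < ‖b k ^ 2‖ := norm_pos_iff.2 (pow_ne_zero _ hb)
  -- The left side bounds the denominator on the unit disc; the right side has order `|b|²`.
  have hγ : 2 + ‖a k + b k‖ < ‖1 - a k * b k‖ := by
    have h5 := mul_lt_mul_of_pos_right h3 hbpos
    rw [add_mul, mul_assoc, ← norm_mul, ← norm_mul, ← norm_mul] at h5
    have e1 : (b k ^ 2)⁻¹ * b k ^ 2 = 1 := inv_mul_cancel₀ (pow_ne_zero _ hb)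
    have e2 : (a k / b k + 1) * (b k)⁻¹ * b k ^ 2 = a k + b k := by field_simp
    have e3 : ((b k ^ 2)⁻¹ - a k / b k) * b k ^ 2 = 1 - a k * b k := by field_simp
    rwa [e1, e2, e3, norm_one, mul_one] at h5
  have hmono : StrictMono fun i => ‖z i‖ := by
    refine strictMono_nat_of_lt_succ fun i => ?_
    have h6 := congrArg norm (hz.step i)
    rw [norm_mul, norm_mul] at h6
    have hzi : 0 < ‖z i‖ := norm_pos_iff.2 (hz.ne_zero i)
    have hD : ‖z i ^ 2 - (a k + b k) * z i + 1‖ < ‖1 - a k * b k‖ := by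
      refine lt_of_le_of_lt ?_ hγ
      have h7 := (hlt i).le
      calc _ ≤ ‖z i‖ ^ 2 + ‖a k + b k‖ * ‖z i‖ + 1 := by
            refine (norm_add_le _ _).trans ?_
            rw [norm_one]
            gcongr
            refine (norm_sub_le _ _).trans ?_
            rw [norm_pow, norm_mul]
        _ ≤ 1 + ‖a k + b k‖ * 1 + 1 := by
            gcongr
            exact pow_le_one₀ hzi.le h7
        _ = _ := by ring
    have hz1 : 0 < ‖z (i + 1)‖ := norm_pos_iff.2 (hz.ne_zero _)
    by_contra hle
    push Not at hle
    have h8 : ‖z (i + 1)‖ * ‖z i ^ 2 - (a k + b k) * z i + 1‖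
        < ‖1 - a k * b k‖ * ‖z i‖ := by
      rw [mul_comm ‖1 - a k * b k‖]
      exact mul_lt_mul' hle hD (norm_nonneg _) hzi
    exact h8.ne h6
  have h9 := hmono hn
  have h10 := hz.periodic 0
  rw [zero_add] at h10
  simp only [h10, lt_irrefl] at h9

end Sphere

end QuadraticCycles

/-! ### The main theorem. -/

open QuadraticCycles

theorem mainTheorem6
    (γ δ a b : ℕ → ℂ)
    (hγ0 : ∀ k, γ k ≠ 0)
    (hfix : ∀ k, quadFix (γ k) (δ k) = {a k, b k, 0})
    (hγ : Tendsto γ atTop (Bornology.cobounded ℂ))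
    (q : ℕ) (ω : ℂ) (hq : 0 < q) (hω : IsPrimitiveRoot ω q) (hω1 : ω ≠ 1)
    (hα : Tendsto (fun k => quadEigenvalue (γ k) (δ k) (a k)) atTop (𝓝 ω)) :
    Tendsto (fun k => quadEigenvalue (γ k) (δ k) (b k)) atTop (𝓝 (starRingEnd ℂ ω)) ∧
    ∀ (n : ℕ) (z : ℕ → OnePoint ℂ), 1 < n →
      (∀ k, HasPeriod (quadMap (γ k) (δ k)) n (z k)) →
      SetsTendTo (fun k => cycleSet (quadMap (γ k) (δ k)) (z k)) {OnePoint.infty} →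
      n = q ∧
      ∀ (w : ℕ → OnePoint ℂ) (W : Set (OnePoint ℂ)),
        (∀ k, HasPeriod (quadMap (γ k) (δ k)) q (w k)) →
        (∀ᶠ k in atTop, cycleSet (quadMap (γ k) (δ k)) (w k) ≠
          cycleSet (quadMap (γ k) (δ k)) (z k)) →
        IsClosed W →
        SetsTendTo (fun k => cycleSet (quadMap (γ k) (δ k)) (w k)) W →
        W = {((0 : ℂ) : OnePoint ℂ), OnePoint.infty} := by
  have hω0 : ω ≠ 0 := hω.ne_zero hq.ne'
  obtain rfl : γ = fun k => 1 - a k * b k := funext fun k => (eq_of_quadFix (hfix k)).1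
  obtain rfl : δ = fun k => -(a k + b k) := funext fun k => (eq_of_quadFix (hfix k)).2
  simp only [quadEigenvalue_left (hγ0 _)] at hα
  simp only [quadEigenvalue_right (hγ0 _)]
  obtain ⟨hp, hβ⟩ := limitParam_of_tendsto hω0 hω1 hγ0 hγ hα
  refine ⟨by rwa [← Complex.inv_eq_conj (hω.norm'_eq_one hq.ne')], ?_⟩
  intro n z hn hz hzlim
  choose u hu hu_orbit hu_inj using fun k => exists_isOrbit (hγ0 k) hn (hz k)
  have hu_mem : ∀ i k, (u k i : OnePoint ℂ) ∈
      cycleSet (quadMap (1 - a k * b k) (-(a k + b k))) (z k) := fun i k => by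
    rw [← hu k i]
    exact Function.iterate_mem_periodicOrbit (HasPeriod.mem_periodicPts (hz k)) i
  have hu_esc : IsEscaping atTop a b n u := ⟨.of_forall hu_orbit, fun i =>
    SetsTendTo.tendsto_inv hzlim subset_rfl (hu_mem i)⟩
  have hnq : n = q := by
    have hdvd : q ∣ n := hu_esc.dvd_period hp hω hω0
    obtain ⟨k, hk⟩ := (hu_esc.eventually_periodic hp hω hω0 (by omega)).exists
    rcases (Nat.le_of_dvd (by omega) hdvd).lt_or_eq with h | h
    · exact absurd (hu_inj k q h 0 (by omega) hk) hq.ne'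
    · exact h.symm
  refine ⟨hnq, ?_⟩
  subst hnq
  intro w W hw hne _ hW
  choose v hv hv_orbit hv_inj using fun k => exists_isOrbit (hγ0 k) hn (hw k)
  have hv_mem : ∀ i k, (v k i : OnePoint ℂ) ∈
      cycleSet (quadMap (1 - a k * b k) (-(a k + b k))) (w k) := fun i k => by
    rw [← hv k i]
    exact Function.iterate_mem_periodicOrbit (HasPeriod.mem_periodicPts (hw k)) i
  have hv_range : ∀ k, ∀ y ∈ cycleSet (quadMap (1 - a k * b k) (-(a k + b k))) (w k),
      ∃ i < n, y = (v k i : OnePoint ℂ) := by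
    intro k y hy
    rw [cycleSet, Set.mem_ofPred_eq, Function.periodicOrbit_def, Cycle.mem_coe_iff,
      List.mem_map] at hy
    obtain ⟨i, hi, rfl⟩ := hy
    rw [List.mem_range, (hw k).2] at hi
    exact ⟨i, hi, hv k i⟩
  have hsub : W ⊆ {((0 : ℂ) : OnePoint ℂ), OnePoint.infty} := by
    intro y hy
    induction y using OnePoint.rec with
    | infty => simp
    | coe p =>
      by_cases hp0 : p = 0
      · simp [hp0]
      · exfalso
        obtain ⟨s, hs⟩ := SetsTendTo.exists_tendsto hW hy hq hv_range
        exact hu_esc.not_tendsto hp hq hω (z' := fun k i => v k (i + s k))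
          (.of_forall fun k => (hv_orbit k).shift (s k)) hp0 (by simpa using hs)
  refine hsub.antisymm ?_
  rintro y (rfl | rfl)
  · by_contra h0
    have hW' : W ⊆ {OnePoint.infty} := fun y hy =>
      (hsub hy).resolve_left (by rintro rfl; exact h0 hy)
    have hv_esc : IsEscaping atTop a b n v := ⟨.of_forall hv_orbit, fun i =>
      SetsTendTo.tendsto_inv hW hW' (hv_mem i)⟩
    -- An ultrafilter makes the coordinates of both cycles converge in the sphere without extracting
    -- subsequences.
    have hU : (hyperfilter ℕ : Filter ℕ) ≤ atTop := Nat.hyperfilter_le_atTop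
    refine (hu_esc.mono hU).false_of_two (hv_esc.mono hU) (hp.mono hU) hq hω hω1 ?_
      (.of_forall hu_inj)
    filter_upwards [hU hne] with k hk i j hij
    refine hk (cycleSet_eq_of_iterate_eq (i := j) (j := i) (HasPeriod.mem_periodicPts (hw k))
      (HasPeriod.mem_periodicPts (hz k)) ?_)
    rw [hv, hu, hij]
  · by_contra h0
    have hV : IsOpen (((↑) : ℂ → OnePoint ℂ) '' Metric.ball 0 1) :=
      OnePoint.isOpenEmbedding_coe.isOpenMap _ Metric.isOpen_ball
    have hWV : W ⊆ ((↑) : ℂ → OnePoint ℂ) '' Metric.ball 0 1 := fun y hy =>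
      ⟨0, by simp, ((hsub hy).resolve_right (by rintro rfl; exact h0 hy)).symm⟩
    obtain ⟨k, h1, h2⟩ := ((SetsTendTo.eventually_subset hW hV hWV).and
      (hp.not_forall_norm_lt hω0 hq)).exists
    refine h2 (v k) (hv_orbit k) fun i => ?_
    obtain ⟨p, hp1, hp2⟩ := h1 (hv_mem i k)
    rw [← OnePoint.coe_injective hp2]
    simpa using hp1

end
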